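/- Let $\mathcal N_{\mathbb C}$ be a complex nuclear Fréchet space, written as the projective limit $\mathcal N_{\mathbb C}=\bigcap_{p\ge 0}\mathcal H_p$ of separable complex Hilbert spaces with norms $\|\cdot\|_p$, where the injections $\mathcal H_q\hookrightarrow\mathcal H_p$ ($q>p$) are Hilbert–Schmidt and $\mathcal N_{\mathbb C}$ is dense in every $\mathcal H_p$. Let $\mathcal N'_{\mathbb C}=\bigcup_{p}\mathcal H_{-p}$, with $\mathcal H_{-p}=\mathcal H_p'$, be its dual. For $p,q\ge 0$ let $\mathcal H_{p,q}$ be $\mathcal H_p$ with the norm $2^{q/2}\|\cdot\|_p$, and let $\Gamma\mathcal H_{p,q}$ be its bosonic Fock space, so that for symmetric $\psi^n\in\mathcal H_p^{\hat\otimes n}$ $$(\sqrt{n!}\,\psi^n)_{n\ge0}\in\Gamma\mathcal H_{p,q}\iff\sum_{n\ge0} n!\,2^{qn}\,\|\psi^n\|^2_{\mathcal H_p^{\otimes n}}<\infty .$$ Let $\beta$ be the white noise measure, that is, the probability measure on $\mathcal N'_{\mathbb C}$ (with the cylinder $\sigma$-algebra) with $\int e^{i(\overline{\langle\rho,\phi\rangle}+\langle\rho,\phi\rangle)}\,d\beta(\phi)=e^{-\|\rho\|_0^2}$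 for all $\rho\in\mathcal N_{\mathbb C}$; let $L^2_{Hol}(\mathcal N'_{\mathbb C},\beta)$ be the closure in $L^2(\mathcal N'_{\mathbb C},\beta)$ of the holomorphic polynomials with coefficients in $\mathcal N_{\mathbb C}$, and let $\mathcal I:L^2_{Hol}(\mathcal N'_{\mathbb C},\beta)\to\Gamma\mathcal H_0$ be the Segal isomorphism, the unitary map that sends a polynomial $\sum_n\langle\psi^n,\phi^{\otimes n}\rangle$ with symmetric coefficients to $(\sqrt{n!}\,\psi^n)_n$. The space of holomorphic Hida test functions is the projective limit of the spaces $\Gamma\mathcal H_{p,q}$, $$(\mathcal N_{\mathbb C})=\bigcap_{p,q\ge0}\mathcal I^{-1}(\Gamma\mathcal H_{p,q})\subset L^2_{Hol}(\mathcal N'_{\mathbb C},\beta);$$ realized as functions defined at every point, it is the set of functions $\Psi:\mathcal N'_{\mathbb C}\to\mathbb C$, $\Psi(\phi)=\sum_{n}\langle\psi^n,\phi^{\otimes n}\rangle$, with coefficients $(\sqrt{n!}\,\psi^n)_n$ in $\bigcap_{p,q\ge0}\Gamma\mathcal H_{p,q}$. Then $(\mathcal N_{\mathbb C})$ is an algebra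 under pointwise multiplication: it is a linear space that contains the constant function $1$, and $\Psi\Phi\in(\mathcal N_{\mathbb C})$ whenever $\Psi,\Phi\in(\mathcal N_{\mathbb C})$. This holds in both realizations, as a space of functions on $\mathcal N'_{\mathbb C}$ and as a subspace of $L^2(\mathcal N'_{\mathbb C},\beta)$. -/

import Mathlib

open MeasureTheory Filter Topology
open scoped ENNReal

noncomputable section

/-! ### Bosonic Fock spaces over a Hilbert space -/

section Fock

variable (K : Type*) [NormedAddCommGroup K] [InnerProductSpace ℂ K]

/-- Continuous `n`-linear forms on the dual `K'` of a Hilbert space `K`. The `n`-fold Hilbert tensor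
power of `K` is the space of those forms that are Hilbert-Schmidt, `χ₁ ⊗ ⋯ ⊗ χₙ` being the form
`(ξ₁, …, ξₙ) ↦ ξ₁(χ₁) ⋯ ξₙ(χₙ)`. -/
abbrev TensorForm (n : ℕ) : Type _ :=
  ContinuousMultilinearMap ℂ (fun _ : Fin n => StrongDual ℂ K) ℂ

variable {K}

/-- The decomposable tensor `χ₁ ⊗ ⋯ ⊗ χₙ`. -/
def tensorForm {n : ℕ} (χ : Fin n → K) : TensorForm K n :=
  (ContinuousMultilinearMap.mkPiAlgebra ℂ (Fin n) ℂ).compContinuousLinearMap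
    (fun i => ContinuousLinearMap.apply ℂ ℂ (χ i))

/-- The symmetrization of `χ₁ ⊗ ⋯ ⊗ χₙ`. -/
def symTensorForm {n : ℕ} (χ : Fin n → K) : TensorForm K n :=
  ((n.factorial : ℂ)⁻¹) • ∑ σ : Equiv.Perm (Fin n), tensorForm (fun i => χ (σ i))

/-- Invariance under permutation of the arguments (bosonic tensors). -/
def TensorForm.IsSymm {n : ℕ} (ψ : TensorForm K n) : Prop :=
  ∀ (σ : Equiv.Perm (Fin n)) (ξ : Fin n → StrongDual ℂ K), ψ (fun i => ξ (σ i)) = ψ ξ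

/-- The square of the Hilbert-Schmidt norm of a form, i.e. of the norm of the `n`-fold Hilbert
tensor power of `K`, computed in an orthonormal basis of `K` (its value does not depend on the
basis). It is `∞` if the form is not Hilbert-Schmidt. -/
def TensorForm.hsNormSq [CompleteSpace K] {n : ℕ} (ψ : TensorForm K n) : ℝ≥0∞ :=
  ∑' i : Fin n → (exists_hilbertBasis ℂ K).choose,
    ‖ψ (fun k => InnerProductSpace.toDual ℂ K (i k : K))‖ₑ ^ 2

/-- `∑ₙ n! ‖ψₙ‖²_{q}` where `‖·‖_q = 2^{qn/2} ‖·‖` is the norm of the `n`-fold tensor power of `K`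
with its norm multiplied by `2^{q/2}`: the squared Fock norm of the sequence `(√n! ψₙ)ₙ`. -/
def fockNormSq [CompleteSpace K] (q : ℕ) (ψ : ∀ n, TensorForm K n) : ℝ≥0∞ :=
  ∑' n, (n.factorial : ℝ≥0∞) * 2 ^ (q * n) * (ψ n).hsNormSq

/-- The sequence `(√n! ψₙ)ₙ` belongs to the bosonic Fock space over `K` with its norm multiplied by
`2^{q/2}`. -/
def IsFock [CompleteSpace K] (q : ℕ) (ψ : ∀ n, TensorForm K n) : Prop :=
  (∀ n, (ψ n).IsSymm) ∧ fockNormSq q ψ < ∞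

variable {L : Type*} [NormedAddCommGroup L] [InnerProductSpace ℂ L]

/-- The map of tensor powers induced by `T : K → L`, with `χ₁ ⊗ ⋯ ⊗ χₙ ↦ Tχ₁ ⊗ ⋯ ⊗ Tχₙ`. -/
def TensorForm.map (T : K →L[ℂ] L) {n : ℕ} (ψ : TensorForm K n) : TensorForm L n :=
  ψ.compContinuousLinearMap
    (fun _ => (ContinuousLinearMap.compL ℂ K L ℂ).flip T)

/-- Hilbert-Schmidt operators between Hilbert spaces. -/
def IsHilbertSchmidt (T : K →L[ℂ] L) : Prop :=
  ∃ (w : Set K) (b : HilbertBasis w ℂ K), Summable (fun i => ‖T (b i)‖ ^ 2)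

end Fock

/-! ### Nuclear Fréchet spaces and their distributions -/

/-- `N` is a nuclear Fréchet space written as the projective limit (with its topology) of the
Hilbert spaces `H 0 ← H 1 ← H 2 ← ⋯`, with Hilbert-Schmidt injections, and dense in each of
them. -/
structure NuclearFrechetChain (N : Type*) [AddCommGroup N] [Module ℂ N] [TopologicalSpace N]
    (H : ℕ → Type*) [∀ p, NormedAddCommGroup (H p)] [∀ p, InnerProductSpace ℂ (H p)] where
  /-- the inclusion of `N` in `H p` -/
  incl : ∀ p, N →L[ℂ] H p
  /-- the injection of `H q` in `H p` -/
  link : ∀ {p q : ℕ}, p ≤ q → (H q →L[ℂ] H p)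
  denseRange_incl : ∀ p, DenseRange (incl p)
  link_incl : ∀ {p q : ℕ} (h : p ≤ q) (x : N), link h (incl q x) = incl p x
  link_injective : ∀ {p q : ℕ} (h : p ≤ q), Function.Injective (link h)
  link_hilbertSchmidt : ∀ {p q : ℕ} (h : p < q), IsHilbertSchmidt (link h.le)
  existsUnique_of_thread : ∀ x : (∀ p, H p), (∀ {p q : ℕ} (h : p ≤ q), link h (x q) = x p) →
    ∃! y : N, ∀ p, incl p y = x p
  isInducing_incl : IsInducing (fun (x : N) (p : ℕ) => incl p x)

/-- The space of distributions: continuous linear functionals on `N`. -/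
def DistributionSpace (N : Type*) [AddCommGroup N] [Module ℂ N] [TopologicalSpace N] : Type _ :=
  N →L[ℂ] ℂ

section Distribution

variable {N : Type*} [AddCommGroup N] [Module ℂ N] [TopologicalSpace N]

instance : FunLike (DistributionSpace N) N ℂ :=
  inferInstanceAs (FunLike (N →L[ℂ] ℂ) N ℂ)

/-- The cylinder `σ`-algebra, generated by the evaluations at elements of `N`; for nuclear Fréchet
`N` it is the Borel `σ`-algebra of the weak and of the strong topology. -/
instance : MeasurableSpace (DistributionSpace N) :=
  ⨆ ρ : N, MeasurableSpace.comap (fun φ : DistributionSpace N => φ ρ) (borel ℂ)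

variable (N) in
/-- Holomorphic polynomials on distributions with coefficients in `N`, written as finite linear
combinations of monomials `φ ↦ φ(χ₁) ⋯ φ(χₙ)`; `terms n` holds the homogeneous part of
degree `n`. -/
structure HolPoly where
  /-- a bound on the degree -/
  deg : ℕ
  /-- the coefficients of the monomials -/
  terms : ∀ n, (Fin n → N) →₀ ℂ
  terms_eq_zero : ∀ n, deg < n → terms n = 0

/-- The value of a polynomial. -/
def HolPoly.eval (P : HolPoly N) (φ : DistributionSpace N) : ℂ :=
  ∑ n ∈ Finset.range (P.deg + 1), (P.terms n).sum (fun χ c => c * ∏ i, φ (χ i))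

end Distribution

namespace NuclearFrechetChain

variable {N : Type*} [AddCommGroup N] [Module ℂ N] [TopologicalSpace N]
  {H : ℕ → Type*} [∀ p, NormedAddCommGroup (H p)] [∀ p, InnerProductSpace ℂ (H p)]
  (C : NuclearFrechetChain N H)

/-- A continuous functional on `H p`, that is an element of `H_{-p}`, seen as a distribution. -/
def toDistribution (p : ℕ) (ξ : StrongDual ℂ (H p)) : DistributionSpace N :=
  ξ.comp (C.incl p)

/-- The white noise measure: its characteristic functional is `ρ ↦ exp (-‖ρ‖₀²)`. -/
def IsWhiteNoise (β : Measure (DistributionSpace N)) : Prop :=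
  ∀ ρ : N, ∫ φ, Complex.exp (Complex.I * ((starRingEnd ℂ) (φ ρ) + φ ρ)) ∂β
    = Complex.exp (-(‖C.incl 0 ρ‖ : ℂ) ^ 2)

/-- The bosonic coefficients of a polynomial, in the symmetric tensor powers of `H 0`. -/
def polyCoeff (P : HolPoly N) (n : ℕ) : TensorForm (H 0) n :=
  (P.terms n).sum (fun χ c => c • symTensorForm (fun i => C.incl 0 (χ i)))

variable [∀ p, CompleteSpace (H p)]

/-- `Ψ` lies in the closed subspace of `L²(β)` spanned by the holomorphic polynomials and its
chaos coefficients are `ψ`, i.e. the Segal isomorphism sends `Ψ` to `(√n! ψₙ)ₙ`. The Segal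
isomorphism is the continuous extension, from the `L²` norm to the Fock norm over `H 0`, of the map
that sends a polynomial to its bosonic coefficients. -/
def IsSegal (β : Measure (DistributionSpace N)) (Ψ : Lp ℂ 2 β) (ψ : ∀ n, TensorForm (H 0) n) : Prop :=
  IsFock 0 ψ ∧ ∃ P : ℕ → HolPoly N,
    Tendsto (fun k => eLpNorm (fun φ => (P k).eval φ - Ψ φ) 2 β) atTop (𝓝 0) ∧
    Tendsto (fun k => fockNormSq 0 (fun n => C.polyCoeff (P k) n - ψ n)) atTop (𝓝 0)

/-- The elements of `L²(β)` whose image under the Segal isomorphism lies in the Fock space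
over `H p` with norm `2^{q/2} ‖·‖_p`. -/
def segalPreimage (β : Measure (DistributionSpace N)) (p q : ℕ) : Set (Lp ℂ 2 β) :=
  {Ψ | ∃ ψ : ∀ n, TensorForm (H p) n, IsFock q ψ ∧
    C.IsSegal β Ψ (fun n => (ψ n).map (C.link (Nat.zero_le p)))}

/-- The space of holomorphic Hida test functions, as a subset of `L²(β)`. -/
def hidaSpace (β : Measure (DistributionSpace N)) : Set (Lp ℂ 2 β) :=
  ⋂ (p : ℕ) (q : ℕ), C.segalPreimage β p q

/-- The elements of the projective limit of all the weighted Fock spaces: compatible families of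
coefficients over all `H p` with finite Fock norms for all weights `q`. -/
structure IsHidaCoeff (ψ : ∀ p n, TensorForm (H p) n) : Prop where
  isFock : ∀ p q, IsFock q (ψ p)
  map_link : ∀ {p q : ℕ} (h : p ≤ q) (n : ℕ), (ψ q n).map (C.link h) = ψ p n

/-- The holomorphic Hida test functions as functions defined at every distribution: the sums
`Ψ(φ) = ∑ₙ ⟨ψₙ, φ^{⊗n}⟩` with coefficients in the projective limit of the weighted Fock spaces.
(Every distribution is given by a continuous functional on some `H p`.) -/
def hidaFunctions : Set (DistributionSpace N → ℂ) :=
  {Ψ | ∃ ψ : ∀ p n, TensorForm (H p) n, C.IsHidaCoeff ψ ∧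
    ∀ (p : ℕ) (ξ : StrongDual ℂ (H p)),
      HasSum (fun n => ψ p n (fun _ => ξ)) (Ψ (C.toDistribution p ξ))}

end NuclearFrechetChain

end

noncomputable section

/-! ### The symmetric product of forms and of Fock sequences -/

/-! Multiplying two power series in `φ` replaces their coefficient sequences by the Cauchy product,
the sum over `k + l = n` of the symmetrized tensors `ψ_k ⊗ φ_l` (`fockMul`). So everything rests on
one estimate, `fockNormSq_fockMul_le`: over a fixed Hilbert space, the squared Fock norm of the
product at weight `q` is at most the product of those of the factors at weight `q + 2`. It follows
from Cauchy–Schwarz on `n + 1` terms, multiplicativity of Hilbert–Schmidt norms, contractivity of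
symmetrization, and `n! (n + 1) ≤ 4^n k! l!`. Since test functions have finite norm for every `q`,
the loss of two is harmless.

For functions on distributions, this estimate and Mertens' theorem on products of absolutely
convergent series suffice.

In `L²` the product must also be identified almost everywhere. On polynomials the `L²` norm equals
the Fock norm (`IsWhiteNoise.lintegral_enorm_sq`): by polarization, polynomials are spanned by the
powers `φ(ρ)^n`, and the moments of the complex Gaussian variables `φ(ρ)` give these the same Gram
matrix as the tensors `√n! ρ^{⊗n}`. If polynomials approximate both factors at weight 2, the
coefficients of their products converge at weight 0, hence the products converge in `L²`, and almost
everywhere along a subsequence to the pointwise product (`IsSegal.exists_mul`). Chaos coefficients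
are unique up to Fock distance zero, so one product serves all `p` and `q`. -/

theorem enorm_sum_sq_le {ι E : Type*} [SeminormedAddCommGroup E] (s : Finset ι) (f : ι → E) :
    ‖∑ i ∈ s, f i‖ₑ ^ 2 ≤ (s.card : ℝ≥0∞) * ∑ i ∈ s, ‖f i‖ₑ ^ 2 := by
  have h : ‖∑ i ∈ s, f i‖₊ ^ 2 ≤ (s.card : NNReal) * ∑ i ∈ s, ‖f i‖₊ ^ 2 :=
    (pow_le_pow_left₀ zero_le (nnnorm_sum_le s f) 2).trans sq_sum_le_card_mul_sum_sq
  simp only [enorm_eq_nnnorm]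
  exact_mod_cast h

section Forms

variable {K : Type*} [NormedAddCommGroup K] [InnerProductSpace ℂ K]
variable {L : Type*} [NormedAddCommGroup L] [InnerProductSpace ℂ L]

namespace TensorForm

theorem update_comp_inl {ι κ μ X : Type*} [DecidableEq ι] [DecidableEq μ] (e : ι ⊕ κ ≃ μ)
    (ξ : μ → X) (s : ι) (z : X) :
    (fun i => Function.update ξ (e (Sum.inl s)) z (e (Sum.inl i)))
      = Function.update (fun i => ξ (e (Sum.inl i))) s z :=
  Function.update_comp_eq_of_injective ξ (e.injective.comp Sum.inl_injective) s z

theorem update_comp_inr {ι κ μ X : Type*} [DecidableEq κ] [DecidableEq μ] (e : ι ⊕ κ ≃ μ)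
    (ξ : μ → X) (s : κ) (z : X) :
    (fun i => Function.update ξ (e (Sum.inr s)) z (e (Sum.inr i)))
      = Function.update (fun i => ξ (e (Sum.inr i))) s z :=
  Function.update_comp_eq_of_injective ξ (e.injective.comp Sum.inr_injective) s z

/-- The tensor product of two forms, the arguments being distributed along `e`. -/
def tmul {k l n : ℕ} (e : Fin k ⊕ Fin l ≃ Fin n) (a : TensorForm K k) (b : TensorForm K l) :
    TensorForm K n where
  toFun ξ := a (fun i => ξ (e (Sum.inl i))) * b (fun j => ξ (e (Sum.inr j)))
  map_update_add' := by
    intro _ ξ i x y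
    obtain ⟨s | s, rfl⟩ := e.surjective i
    · simp [update_comp_inl, ContinuousMultilinearMap.map_update_add, add_mul]
    · simp [update_comp_inr, ContinuousMultilinearMap.map_update_add, mul_add]
  map_update_smul' := by
    intro _ ξ i c x
    obtain ⟨s | s, rfl⟩ := e.surjective i
    · simp [update_comp_inl, ContinuousMultilinearMap.map_update_smul, mul_assoc]
    · simp [update_comp_inr, ContinuousMultilinearMap.map_update_smul, mul_left_comm]
  cont := by
    refine (a.cont.comp ?_).mul (b.cont.comp ?_) <;> fun_prop

theorem tmul_apply {k l n : ℕ} (e : Fin k ⊕ Fin l ≃ Fin n) (a : TensorForm K k)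
    (b : TensorForm K l) (ξ : Fin n → StrongDual ℂ K) :
    tmul e a b ξ = a (fun i => ξ (e (Sum.inl i))) * b (fun j => ξ (e (Sum.inr j))) := rfl

/-- Symmetrization of a form. -/
def symmetrize {n : ℕ} (a : TensorForm K n) : TensorForm K n :=
  ((n.factorial : ℂ)⁻¹) • ∑ σ : Equiv.Perm (Fin n), a.domDomCongr σ

theorem symmetrize_apply {n : ℕ} (a : TensorForm K n) (ξ : Fin n → StrongDual ℂ K) :
    a.symmetrize ξ = (n.factorial : ℂ)⁻¹ * ∑ σ : Equiv.Perm (Fin n), a (fun i => ξ (σ i)) := by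
  simp [symmetrize]

theorem isSymm_symmetrize {n : ℕ} (a : TensorForm K n) : a.symmetrize.IsSymm := by
  intro τ ξ
  rw [symmetrize_apply, symmetrize_apply]
  congr 1
  exact Fintype.sum_equiv (Equiv.mulLeft τ) _ _ (fun σ => rfl)

theorem symmetrize_apply_const {n : ℕ} (a : TensorForm K n) (ξ : StrongDual ℂ K) :
    a.symmetrize (fun _ => ξ) = a (fun _ => ξ) := by
  rw [symmetrize_apply, Finset.sum_const, Finset.card_univ, Fintype.card_perm, Fintype.card_fin,
    nsmul_eq_mul, inv_mul_cancel_left₀ (by exact_mod_cast n.factorial_ne_zero)]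

theorem symmetrize_zero {n : ℕ} : (0 : TensorForm K n).symmetrize = 0 := by
  ext ξ; simp [symmetrize_apply]

theorem symmetrize_add {n : ℕ} (a b : TensorForm K n) :
    (a + b).symmetrize = a.symmetrize + b.symmetrize := by
  ext ξ; simp [symmetrize_apply, Finset.sum_add_distrib, mul_add]

theorem symmetrize_smul {n : ℕ} (c : ℂ) (a : TensorForm K n) :
    (c • a).symmetrize = c • a.symmetrize := by
  ext ξ; simp [symmetrize_apply, ← Finset.mul_sum, mul_left_comm]

theorem map_apply (T : K →L[ℂ] L) {n : ℕ} (a : TensorForm K n) (ξ : Fin n → StrongDual ℂ L) :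
    a.map T ξ = a (fun i => (ξ i).comp T) := rfl

theorem map_id {n : ℕ} (a : TensorForm K n) : a.map (ContinuousLinearMap.id ℂ K) = a := by
  ext ξ; simp [map_apply]

theorem map_symmetrize (T : K →L[ℂ] L) {n : ℕ} (a : TensorForm K n) :
    a.symmetrize.map T = (a.map T).symmetrize := by
  ext ξ; simp [map_apply, symmetrize_apply]

theorem map_tmul (T : K →L[ℂ] L) {k l n : ℕ} (e : Fin k ⊕ Fin l ≃ Fin n) (a : TensorForm K k)
    (b : TensorForm K l) : (tmul e a b).map T = tmul e (a.map T) (b.map T) := rfl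

theorem IsSymm.map {n : ℕ} {a : TensorForm K n} (ha : a.IsSymm) (T : K →L[ℂ] L) :
    (a.map T).IsSymm := fun σ ξ => ha σ (fun i => (ξ i).comp T)

theorem IsSymm.add {n : ℕ} {a b : TensorForm K n} (ha : a.IsSymm) (hb : b.IsSymm) :
    (a + b).IsSymm := fun σ ξ => by simp [ha σ ξ, hb σ ξ]

theorem IsSymm.smul {n : ℕ} {a : TensorForm K n} (ha : a.IsSymm) (c : ℂ) :
    (c • a).IsSymm := fun σ ξ => by simp [ha σ ξ]

theorem IsSymm.sum {ι : Type*} {n : ℕ} {s : Finset ι} {a : ι → TensorForm K n}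
    (ha : ∀ i ∈ s, (a i).IsSymm) : (∑ i ∈ s, a i).IsSymm := fun σ ξ => by
  simp only [sum_apply]
  exact Finset.sum_congr rfl fun i hi => ha i hi σ ξ

/-! ### Hilbert–Schmidt norms of products and symmetrizations. -/

section HilbertSchmidt

variable [CompleteSpace K]

theorem hsNormSq_zero {n : ℕ} : (0 : TensorForm K n).hsNormSq = 0 := by
  simp [hsNormSq]

theorem hsNormSq_smul {n : ℕ} (c : ℂ) (a : TensorForm K n) :
    (c • a).hsNormSq = ‖c‖ₑ ^ 2 * a.hsNormSq := by
  simp only [hsNormSq, smul_apply, enorm_smul, mul_pow,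
    ENNReal.tsum_mul_left]

theorem hsNormSq_sum_le {ι : Type*} (s : Finset ι) {n : ℕ} (a : ι → TensorForm K n) :
    (∑ i ∈ s, a i).hsNormSq ≤ (s.card : ℝ≥0∞) * ∑ i ∈ s, (a i).hsNormSq := by
  simp only [hsNormSq, sum_apply]
  rw [← Summable.tsum_finsetSum (fun _ _ => ENNReal.summable), ← ENNReal.tsum_mul_left]
  exact ENNReal.tsum_le_tsum fun i => enorm_sum_sq_le _ _

theorem hsNormSq_domDomCongr {n : ℕ} (σ : Equiv.Perm (Fin n)) (a : TensorForm K n) :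
    TensorForm.hsNormSq (a.domDomCongr σ) = a.hsNormSq := by
  simp only [hsNormSq]
  exact Equiv.tsum_eq (σ.arrowCongr (Equiv.refl _)).symm
    (fun i : Fin n → (exists_hilbertBasis ℂ K).choose =>
      ‖a (fun k => InnerProductSpace.toDual ℂ K (i k : K))‖ₑ ^ 2)

/-- Symmetrization averages permuted copies of `a`, all of the same norm; Cauchy–Schwarz yields a
factor `n! · n!` that cancels the square of the normalization. -/
theorem hsNormSq_symmetrize_le {n : ℕ} (a : TensorForm K n) :
    a.symmetrize.hsNormSq ≤ a.hsNormSq := by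
  have h := hsNormSq_sum_le (Finset.univ : Finset (Equiv.Perm (Fin n)))
    (fun σ => (a.domDomCongr σ : TensorForm K n))
  simp only [hsNormSq_domDomCongr, Finset.sum_const, Finset.card_univ, Fintype.card_perm,
    Fintype.card_fin, nsmul_eq_mul] at h
  rw [symmetrize, hsNormSq_smul]
  have h0 : (n.factorial : ℝ≥0∞) ≠ 0 := by exact_mod_cast n.factorial_ne_zero
  have hc : ‖(n.factorial : ℂ)⁻¹‖ₑ = (n.factorial : ℝ≥0∞)⁻¹ := by
    rw [enorm_inv (by exact_mod_cast n.factorial_ne_zero)]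
    simp [enorm_eq_nnnorm]
  calc _ ≤ ((n.factorial : ℝ≥0∞)⁻¹) ^ 2 * (n.factorial * (n.factorial * a.hsNormSq)) := by
        rw [hc]; gcongr
    _ = ((n.factorial : ℝ≥0∞)⁻¹ * n.factorial) * ((n.factorial : ℝ≥0∞)⁻¹ * n.factorial)
        * a.hsNormSq := by ring
    _ = a.hsNormSq := by
        rw [ENNReal.inv_mul_cancel h0 (ENNReal.natCast_ne_top _)]; simp

/-- Splitting a multi-index along `e` turns the sum over basis tuples into a double sum that
factors. -/
theorem hsNormSq_tmul {k l n : ℕ} (e : Fin k ⊕ Fin l ≃ Fin n) (a : TensorForm K k)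
    (b : TensorForm K l) : (tmul e a b).hsNormSq = a.hsNormSq * b.hsNormSq := by
  simp only [hsNormSq, tmul_apply, enorm_mul, mul_pow]
  rw [← ENNReal.tsum_mul_right]
  simp_rw [← ENNReal.tsum_mul_left]
  rw [← ENNReal.tsum_prod]
  exact Equiv.tsum_eq ((e.arrowCongr (Equiv.refl _)).symm.trans
      (Equiv.sumArrowEquivProdArrow (Fin k) (Fin l) (exists_hilbertBasis ℂ K).choose))
    (fun p => ‖a (fun i => InnerProductSpace.toDual ℂ K (p.1 i : K))‖ₑ ^ 2 *
      ‖b (fun i => InnerProductSpace.toDual ℂ K (p.2 i : K))‖ₑ ^ 2)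

end HilbertSchmidt

end TensorForm

/-- One side permutes the vectors, the other the arguments; inverting the permutation exchanges the
two. -/
theorem symTensorForm_eq_symmetrize {n : ℕ} (χ : Fin n → K) :
    symTensorForm χ = (tensorForm χ).symmetrize := by
  ext ξ
  rw [TensorForm.symmetrize_apply]
  simp only [symTensorForm, smul_apply, sum_apply, smul_eq_mul]
  congr 1
  refine Fintype.sum_equiv (Equiv.inv _) _ _ fun σ => ?_
  simp only [tensorForm, ContinuousMultilinearMap.compContinuousLinearMap_apply,
    ContinuousMultilinearMap.mkPiAlgebra_apply, ContinuousLinearMap.apply_apply]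
  exact Fintype.prod_equiv σ _ _ fun i => by simp

/-- The symmetric product of sequences of forms. -/
def fockMul (a b : ∀ n, TensorForm K n) (n : ℕ) : TensorForm K n :=
  -- The index ranges over a subtype because the proof of `k + l = n` is needed to cast `Fin (k +
  -- l)` to `Fin n`.
  ∑ p : Finset.HasAntidiagonal.antidiagonal n, (TensorForm.tmul
    (finSumFinEquiv.trans (finCongr (Finset.HasAntidiagonal.mem_antidiagonal.1 p.2))) (a p.1.1) (b p.1.2)).symmetrize

theorem isSymm_fockMul (a b : ∀ n, TensorForm K n) (n : ℕ) : (fockMul a b n).IsSymm :=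
  TensorForm.IsSymm.sum fun _ _ => TensorForm.isSymm_symmetrize _

theorem fockMul_add_left (a a' b : ∀ n, TensorForm K n) :
    fockMul (a + a') b = fockMul a b + fockMul a' b := by
  funext n
  simp only [fockMul, Pi.add_apply, ← Finset.sum_add_distrib, ← TensorForm.symmetrize_add]
  refine Finset.sum_congr rfl fun p _ => congrArg _ ?_
  ext ξ; simp [TensorForm.tmul_apply, add_mul]

theorem fockMul_add_right (a b b' : ∀ n, TensorForm K n) :
    fockMul a (b + b') = fockMul a b + fockMul a b' := by
  funext n
  simp only [fockMul, Pi.add_apply, ← Finset.sum_add_distrib, ← TensorForm.symmetrize_add]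
  refine Finset.sum_congr rfl fun p _ => congrArg _ ?_
  ext ξ; simp [TensorForm.tmul_apply, mul_add]

theorem fockMul_smul_left (c : ℂ) (a b : ∀ n, TensorForm K n) :
    fockMul (c • a) b = c • fockMul a b := by
  funext n
  simp only [fockMul, Pi.smul_apply, Finset.smul_sum, ← TensorForm.symmetrize_smul]
  refine Finset.sum_congr rfl fun p _ => congrArg _ ?_
  ext ξ; simp [TensorForm.tmul_apply, mul_assoc]

theorem fockMul_smul_right (c : ℂ) (a b : ∀ n, TensorForm K n) :
    fockMul a (c • b) = c • fockMul a b := by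
  funext n
  simp only [fockMul, Pi.smul_apply, Finset.smul_sum, ← TensorForm.symmetrize_smul]
  refine Finset.sum_congr rfl fun p _ => congrArg _ ?_
  ext ξ; simp [TensorForm.tmul_apply, mul_left_comm]

theorem fockMul_zero_left (b : ∀ n, TensorForm K n) : fockMul 0 b = 0 := by
  funext n
  ext ξ
  simp [fockMul, TensorForm.symmetrize_apply, TensorForm.tmul_apply]

theorem fockMul_zero_right (a : ∀ n, TensorForm K n) : fockMul a 0 = 0 := by
  funext n
  ext ξ
  simp [fockMul, TensorForm.symmetrize_apply, TensorForm.tmul_apply]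

/-- The bilinear telescoping behind both the continuity of the product and its independence of the
chosen coefficients. -/
theorem fockMul_sub_fockMul (a a' b b' : ∀ n, TensorForm K n) :
    fockMul a b - fockMul a' b' = fockMul (a - a') b + fockMul a' (b - b') := by
  have h1 := fockMul_add_left (a - a') a' b
  have h2 := fockMul_add_right a' (b - b') b'
  rw [show a - a' + a' = a from sub_add_cancel a a'] at h1
  rw [show b - b' + b' = b from sub_add_cancel b b'] at h2
  rw [h1, h2]
  funext n
  simp only [Pi.sub_apply, Pi.add_apply]
  abel

theorem map_fockMul (T : K →L[ℂ] L) (a b : ∀ n, TensorForm K n) (n : ℕ) :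
    (fockMul a b n).map T = fockMul (fun n => (a n).map T) (fun n => (b n).map T) n := by
  simp only [fockMul, ← TensorForm.map_tmul, ← TensorForm.map_symmetrize]
  ext ξ
  simp [TensorForm.map_apply]

theorem fockMul_apply_const (a b : ∀ n, TensorForm K n) (n : ℕ) (ξ : StrongDual ℂ K) :
    fockMul a b n (fun _ => ξ)
      = ∑ p ∈ Finset.HasAntidiagonal.antidiagonal n, a p.1 (fun _ => ξ) * b p.2 (fun _ => ξ) := by
  simp only [fockMul, sum_apply, TensorForm.symmetrize_apply_const, TensorForm.tmul_apply]
  exact Finset.sum_coe_sort (Finset.HasAntidiagonal.antidiagonal n)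
    (fun p => a p.1 (fun _ => ξ) * b p.2 (fun _ => ξ))

/-! ### Weighted Fock norms and the product estimate. -/

section FockNorm

variable [CompleteSpace K]

theorem hsNormSq_fockMul_le (a b : ∀ n, TensorForm K n) (n : ℕ) :
    (fockMul a b n).hsNormSq ≤ ((n + 1 : ℕ) : ℝ≥0∞) *
      ∑ p ∈ Finset.HasAntidiagonal.antidiagonal n, (a p.1).hsNormSq * (b p.2).hsNormSq := by
  refine (TensorForm.hsNormSq_sum_le _ _).trans ?_
  rw [Finset.card_univ, Fintype.card_coe, Finset.Nat.card_antidiagonal,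
    ← Finset.sum_coe_sort (Finset.HasAntidiagonal.antidiagonal n)]
  gcongr with p
  exact (TensorForm.hsNormSq_symmetrize_le _).trans (TensorForm.hsNormSq_tmul _ _ _).le

theorem ENNReal.tsum_antidiagonal_mul (f g : ℕ → ℝ≥0∞) :
    ∑' n, ∑ p ∈ Finset.HasAntidiagonal.antidiagonal n, f p.1 * g p.2 = (∑' n, f n) * ∑' n, g n := by
  rw [← ENNReal.tsum_mul_right]
  simp_rw [← ENNReal.tsum_mul_left]
  rw [← ENNReal.tsum_prod, ← (Finset.HasAntidiagonal.sigmaAntidiagonalEquivProd (A := ℕ)).tsum_eq,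
    ENNReal.tsum_sigma']
  refine tsum_congr fun n => ?_
  rw [tsum_fintype]
  exact (Finset.sum_coe_sort (Finset.HasAntidiagonal.antidiagonal n) (fun p => f p.1 * g p.2)).symm

/-- Weight `q + 2` supplies an extra `4^k · 4^l = 4^n`: one factor `2^n` pays for the binomial
coefficient in `n! = C(n,k) k! l!`, the other for the `n + 1` terms of the Cauchy product. What
remains is a product of two series. -/
theorem fockNormSq_fockMul_le (q : ℕ) (a b : ∀ n, TensorForm K n) :
    fockNormSq q (fockMul a b) ≤ fockNormSq (q + 2) a * fockNormSq (q + 2) b := by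
  rw [fockNormSq, fockNormSq, fockNormSq, ← ENNReal.tsum_antidiagonal_mul]
  refine ENNReal.tsum_le_tsum fun n => ?_
  calc _ ≤ (n.factorial : ℝ≥0∞) * 2 ^ (q * n) * (((n + 1 : ℕ) : ℝ≥0∞) *
        ∑ p ∈ Finset.HasAntidiagonal.antidiagonal n, (a p.1).hsNormSq * (b p.2).hsNormSq) := by
        gcongr; exact hsNormSq_fockMul_le a b n
    _ = ∑ p ∈ Finset.HasAntidiagonal.antidiagonal n, ((n.factorial * 2 ^ (q * n) * (n + 1) : ℕ) : ℝ≥0∞) *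
        ((a p.1).hsNormSq * (b p.2).hsNormSq) := by
        rw [← mul_assoc, Finset.mul_sum]; push_cast; rfl
    _ ≤ _ := Finset.sum_le_sum fun p hp => ?_
  obtain ⟨k, l⟩ := p
  obtain rfl : k + l = n := Finset.HasAntidiagonal.mem_antidiagonal.1 hp
  have h1 : (k + l).factorial ≤ 2 ^ (k + l) * (k.factorial * l.factorial) := by
    rw [← Nat.add_choose_mul_factorial_mul_factorial, mul_assoc]
    exact Nat.mul_le_mul_right _ (Nat.choose_le_two_pow _ _)
  have h2 : k + l + 1 ≤ 2 ^ (k + l) := Nat.lt_two_pow_self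
  have h3 : (k + l).factorial * 2 ^ (q * (k + l)) * (k + l + 1)
      ≤ (k.factorial * 2 ^ ((q + 2) * k)) * (l.factorial * 2 ^ ((q + 2) * l)) :=
    calc _ ≤ (2 ^ (k + l) * (k.factorial * l.factorial)) * 2 ^ (q * (k + l)) * 2 ^ (k + l) := by
          gcongr
      _ = _ := by ring
  calc _ ≤ (((k.factorial * 2 ^ ((q + 2) * k)) * (l.factorial * 2 ^ ((q + 2) * l)) : ℕ) : ℝ≥0∞) *
        ((a k).hsNormSq * (b l).hsNormSq) := by gcongr
    _ = _ := by push_cast; ring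

theorem fockNormSq_zero (q : ℕ) : fockNormSq q (0 : ∀ n, TensorForm K n) = 0 := by
  simp [fockNormSq, TensorForm.hsNormSq_zero]

theorem fockNormSq_smul (q : ℕ) (c : ℂ) (a : ∀ n, TensorForm K n) :
    fockNormSq q (c • a) = ‖c‖ₑ ^ 2 * fockNormSq q a := by
  simp only [fockNormSq, Pi.smul_apply, TensorForm.hsNormSq_smul, ← ENNReal.tsum_mul_left]
  exact tsum_congr fun n => by ring

theorem fockNormSq_neg (q : ℕ) (a : ∀ n, TensorForm K n) :
    fockNormSq q (-a) = fockNormSq q a := by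
  rw [← neg_one_smul ℂ a, fockNormSq_smul]; simp

theorem fockNormSq_sub_comm (q : ℕ) (a b : ∀ n, TensorForm K n) :
    fockNormSq q (a - b) = fockNormSq q (b - a) := by
  rw [show a - b = -(b - a) from (neg_sub b a).symm, fockNormSq_neg]

theorem TensorForm.hsNormSq_add_le {n : ℕ} (a b : TensorForm K n) :
    (a + b).hsNormSq ≤ 2 * (a.hsNormSq + b.hsNormSq) := by
  simpa using TensorForm.hsNormSq_sum_le Finset.univ ![a, b]

theorem fockNormSq_add_le (q : ℕ) (a b : ∀ n, TensorForm K n) :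
    fockNormSq q (a + b) ≤ 2 * (fockNormSq q a + fockNormSq q b) := by
  rw [fockNormSq, fockNormSq, fockNormSq, ← ENNReal.tsum_add, ← ENNReal.tsum_mul_left]
  refine ENNReal.tsum_le_tsum fun n => ?_
  calc _ ≤ (n.factorial : ℝ≥0∞) * 2 ^ (q * n) * (2 * ((a n).hsNormSq + (b n).hsNormSq)) := by
        gcongr; exact TensorForm.hsNormSq_add_le _ _
    _ = _ := by ring

theorem fockNormSq_sub_le (q : ℕ) (a b c : ∀ n, TensorForm K n) :
    fockNormSq q (a - c) ≤ 2 * (fockNormSq q (a - b) + fockNormSq q (b - c)) := by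
  have h := fockNormSq_add_le q (a - b) (b - c)
  rwa [show a - b + (b - c) = a - c from sub_add_sub_cancel a b c] at h

theorem fockNormSq_mono {q r : ℕ} (h : q ≤ r) (a : ∀ n, TensorForm K n) :
    fockNormSq q a ≤ fockNormSq r a :=
  ENNReal.tsum_le_tsum fun n => by gcongr; exact one_le_two

theorem IsFock.add {q : ℕ} {a b : ∀ n, TensorForm K n} (ha : IsFock q a) (hb : IsFock q b) :
    IsFock q (a + b) :=
  ⟨fun n => (ha.1 n).add (hb.1 n), (fockNormSq_add_le q a b).trans_lt
    (ENNReal.mul_lt_top (by simp) (ENNReal.add_lt_top.2 ⟨ha.2, hb.2⟩))⟩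

theorem IsFock.smul {q : ℕ} {a : ∀ n, TensorForm K n} (ha : IsFock q a) (c : ℂ) :
    IsFock q (c • a) :=
  ⟨fun n => (ha.1 n).smul c, by
    rw [fockNormSq_smul]; exact ENNReal.mul_lt_top (by simp) ha.2⟩

theorem IsFock.fockMul {q : ℕ} {a b : ∀ n, TensorForm K n} (ha : IsFock (q + 2) a)
    (hb : IsFock (q + 2) b) : IsFock q (fockMul a b) :=
  ⟨isSymm_fockMul a b, (fockNormSq_fockMul_le q a b).trans_lt (ENNReal.mul_lt_top ha.2 hb.2)⟩

variable (K) in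
/-- The sequence of the constant `c`. -/
def fockConst (c : ℂ) : ∀ n, TensorForm K n
  | 0 => ContinuousMultilinearMap.constOfIsEmpty ℂ _ c
  | _ + 1 => 0

theorem isFock_fockConst (q : ℕ) (c : ℂ) : IsFock q (fockConst K c) := by
  refine ⟨fun n => ?_, ?_⟩
  · cases n
    · intro σ ξ; simp [fockConst]
    · intro σ ξ; simp [fockConst]
  · rw [fockNormSq, tsum_eq_single 0]
    · simp [fockConst, TensorForm.hsNormSq]
    · intro n hn
      obtain ⟨m, rfl⟩ := Nat.exists_eq_succ_of_ne_zero hn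
      simp [fockConst, TensorForm.hsNormSq_zero]

end FockNorm

theorem map_fockConst (T : K →L[ℂ] L) (c : ℂ) (n : ℕ) :
    (fockConst K c n).map T = fockConst L c n := by
  cases n <;> ext ξ <;> simp [fockConst, TensorForm.map_apply]

theorem hasSum_fockConst (c : ℂ) (ξ : StrongDual ℂ K) :
    HasSum (fun n => fockConst K c n (fun _ => ξ)) c := by
  refine hasSum_single (f := fun n => fockConst K c n (fun _ => ξ)) 0 fun n hn => ?_
  obtain ⟨m, rfl⟩ := Nat.exists_eq_succ_of_ne_zero hn
  simp [fockConst]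

end Forms

/-! ### The algebra of functions defined at every distribution. -/

namespace NuclearFrechetChain

variable {N : Type*} [AddCommGroup N] [Module ℂ N] [TopologicalSpace N]
  {H : ℕ → Type*} [∀ p, NormedAddCommGroup (H p)] [∀ p, InnerProductSpace ℂ (H p)]
  [∀ p, CompleteSpace (H p)] (C : NuclearFrechetChain N H)

/-- The holomorphic Hida test functions form an algebra of functions. -/
def hidaSubalgebra : Subalgebra ℂ (DistributionSpace N → ℂ) where
  carrier := C.hidaFunctions
  add_mem' := by
    rintro Ψ Φ ⟨ψ, hψ, hΨ⟩ ⟨φ, hφ, hΦ⟩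
    refine ⟨fun p => ψ p + φ p, ⟨fun p q => (hψ.isFock p q).add (hφ.isFock p q), ?_⟩, ?_⟩
    · intro p q h n
      exact congrArg₂ (· + ·) (hψ.map_link h n) (hφ.map_link h n)
    · exact fun p ξ => (hΨ p ξ).add (hΦ p ξ)
  mul_mem' := by
    rintro Ψ Φ ⟨ψ, hψ, hΨ⟩ ⟨φ, hφ, hΦ⟩
    refine ⟨fun p => fockMul (ψ p) (φ p),
      ⟨fun p q => (hψ.isFock p (q + 2)).fockMul (hφ.isFock p (q + 2)), ?_⟩, ?_⟩
    · intro p q h n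
      rw [map_fockMul]
      simp only [hψ.map_link h, hφ.map_link h]
    · intro p ξ
      -- Summability in `ℂ` is absolute, so the Cauchy product of the two series converges to the
      -- product of their sums.
      have h1 := (hΨ p ξ).summable.norm
      have h2 := (hΦ p ξ).summable.norm
      simp only [fockMul_apply_const, Pi.mul_apply, ← (hΨ p ξ).tsum_eq, ← (hΦ p ξ).tsum_eq]
      rw [tsum_mul_tsum_eq_tsum_sum_antidiagonal_of_summable_norm h1 h2]
      exact (summable_norm_sum_mul_antidiagonal_of_summable_norm h1 h2).of_norm.hasSum
  algebraMap_mem' := fun c =>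
    ⟨fun p => fockConst (H p) c,
      ⟨fun _ q => isFock_fockConst q c, fun h n => map_fockConst (C.link h) c n⟩,
      fun _ ξ => hasSum_fockConst c ξ⟩

end NuclearFrechetChain

/-! ### Complex Gaussian variables -/

section ComplexGaussian

open ProbabilityTheory

/-- The centred circular Gaussian measure on `ℂ` with `∫ ‖z‖² = b⁻¹`. -/
def complexGaussian (b : ℝ) : Measure ℂ :=
  volume.withDensity fun z => ENNReal.ofReal (b / Real.pi * Real.exp (-b * ‖z‖ ^ 2))

theorem integral_norm_pow_mul_exp {b : ℝ} (hb : 0 < b) (k : ℕ) :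
    ∫ z : ℂ, ‖z‖ ^ k * Real.exp (-b * ‖z‖ ^ 2)
      = Real.pi * b ^ (-((k : ℝ) + 2) / 2) * Real.Gamma (((k : ℝ) + 2) / 2) := by
  have h := Complex.integral_rpow_mul_exp_neg_mul_rpow (p := 2) (q := k) (b := b) one_le_two
    (by linarith [Nat.cast_nonneg (α := ℝ) k]) hb
  simp only [Real.rpow_natCast, Real.rpow_ofNat] at h
  rw [h]
  congr 2
  ring

/-- The Bochner integral of a non-integrable function is `0` by convention, whereas the closed
formula for this one is positive. -/
theorem integrable_norm_pow_mul_exp {b : ℝ} (hb : 0 < b) (k : ℕ) :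
    Integrable fun z : ℂ => ‖z‖ ^ k * Real.exp (-b * ‖z‖ ^ 2) := by
  by_contra h
  have h1 := integral_norm_pow_mul_exp hb k
  rw [integral_undef h] at h1
  have h2 : 0 < Real.Gamma (((k : ℝ) + 2) / 2) := Real.Gamma_pos_of_pos (by positivity)
  have : 0 < Real.pi * b ^ (-((k : ℝ) + 2) / 2) * Real.Gamma (((k : ℝ) + 2) / 2) := by positivity
  linarith

theorem measurable_complexGaussian_density (b : ℝ) :
    Measurable fun z : ℂ => ENNReal.ofReal (b / Real.pi * Real.exp (-b * ‖z‖ ^ 2)) := by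
  fun_prop

theorem integral_complexGaussian {E : Type*} [NormedAddCommGroup E] [NormedSpace ℝ E]
    {b : ℝ} (hb : 0 < b) (f : ℂ → E) :
    ∫ z, f z ∂complexGaussian b
      = ∫ z : ℂ, (b / Real.pi * Real.exp (-b * ‖z‖ ^ 2)) • f z := by
  rw [complexGaussian, integral_withDensity_eq_integral_toReal_smul
    (measurable_complexGaussian_density b) (by simp)]
  refine integral_congr_ae (.of_forall fun z => ?_)
  simp only
  rw [ENNReal.toReal_ofReal (by positivity)]

theorem isFiniteMeasure_complexGaussian {b : ℝ} (hb : 0 < b) :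
    IsFiniteMeasure (complexGaussian b) := by
  refine isFiniteMeasure_withDensity_ofReal ?_
  have h := (integrable_norm_pow_mul_exp hb 0).const_mul (b / Real.pi)
  simp only [pow_zero, one_mul] at h
  exact h.2

theorem integrable_norm_pow_complexGaussian {b : ℝ} (hb : 0 < b) (k : ℕ) :
    Integrable (fun z : ℂ => ‖z‖ ^ k) (complexGaussian b) := by
  rw [complexGaussian, integrable_withDensity_iff (measurable_complexGaussian_density b) (by simp)]
  refine ((integrable_norm_pow_mul_exp hb k).const_mul (b / Real.pi)).congr
    (.of_forall fun z => ?_)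
  simp only
  rw [ENNReal.toReal_ofReal (by positivity)]
  ring

theorem integral_norm_pow_complexGaussian {b : ℝ} (hb : 0 < b) (k : ℕ) :
    ∫ z : ℂ, ‖z‖ ^ (2 * k) ∂complexGaussian b = k.factorial * (b⁻¹) ^ k := by
  rw [integral_complexGaussian hb]
  have h : ∀ z : ℂ, (b / Real.pi * Real.exp (-b * ‖z‖ ^ 2)) • ‖z‖ ^ (2 * k)
      = b / Real.pi * (‖z‖ ^ (2 * k) * Real.exp (-b * ‖z‖ ^ 2)) := fun z => by
    rw [smul_eq_mul]; ring
  simp_rw [h]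
  rw [integral_const_mul, integral_norm_pow_mul_exp hb]
  push_cast
  rw [show (2 * (k : ℝ) + 2) / 2 = k + 1 by ring, Real.Gamma_nat_eq_factorial,
    show -(2 * (k : ℝ) + 2) / 2 = -((k + 1 : ℕ) : ℝ) by push_cast; ring, Real.rpow_neg hb.le,
    Real.rpow_natCast]
  have := Real.pi_ne_zero
  rw [inv_pow, pow_succ]
  field_simp

theorem charFun_complexGaussian {b : ℝ} (hb : 0 < b) (t : ℂ) :
    charFun (complexGaussian b) t = Complex.exp (-(b⁻¹ * ‖t‖ ^ 2 / 4 : ℝ)) := by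
  rw [charFun_apply, integral_complexGaussian hb]
  have h := GaussianFourier.integral_cexp_neg_mul_sq_norm_add (V := ℂ) (b := b) (by simpa)
    Complex.I t
  have h2 : ∀ z : ℂ, (b / Real.pi * Real.exp (-b * ‖z‖ ^ 2)) •
      Complex.exp ((inner ℝ z t : ℝ) * Complex.I)
      = (b / Real.pi : ℂ) * Complex.exp (-b * ‖z‖ ^ 2 + Complex.I * (inner ℝ t z : ℝ)) := by
    intro z
    rw [real_inner_comm, Complex.exp_add, Complex.real_smul]
    push_cast
    ring_nf
  simp_rw [h2]
  rw [integral_const_mul, h]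
  have hb' : (b : ℂ) ≠ 0 := by exact_mod_cast hb.ne'
  have hp : (Real.pi : ℂ) ≠ 0 := by exact_mod_cast Real.pi_ne_zero
  rw [Complex.finrank_real_complex]
  norm_num
  rw [← mul_assoc, div_mul_div_cancel₀ hp, div_self hb', one_mul]
  congr 1
  ring

variable {Ω : Type*} [MeasurableSpace Ω] {μ : Measure Ω} [IsProbabilityMeasure μ] {X : Ω → ℂ}

theorem map_eq_complexGaussian {b : ℝ} (hb : 0 < b)
    (h : ∀ t, charFun (μ.map X) t = Complex.exp (-(b⁻¹ * ‖t‖ ^ 2 / 4 : ℝ))) :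
    μ.map X = complexGaussian b := by
  have := isFiniteMeasure_complexGaussian hb
  exact Measure.ext_of_charFun (funext fun t => (h t).trans (charFun_complexGaussian hb t).symm)

/-- Equal exponents reduce to a radial moment; for different ones, rotation invariance of the
measure forces the integral to equal its own negative. -/
theorem integral_pow_mul_conj_pow_complexGaussian {b : ℝ} (hb : 0 < b) (n m : ℕ) :
    ∫ z : ℂ, z ^ n * (starRingEnd ℂ z) ^ m ∂complexGaussian b
      = if n = m then (n.factorial : ℂ) * ((b⁻¹ : ℝ) : ℂ) ^ n else 0 := by
  split_ifs with h
  · subst h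
    have h1 : ∀ z : ℂ, z ^ n * (starRingEnd ℂ z) ^ n = ((‖z‖ ^ (2 * n) : ℝ) : ℂ) := fun z => by
      rw [← mul_pow, Complex.mul_conj, Complex.normSq_eq_norm_sq, pow_mul]
      push_cast; rfl
    simp_rw [h1]
    rw [integral_complex_ofReal, integral_norm_pow_complexGaussian hb]
    push_cast; rfl
  -- The angle `π / (n - m)` is chosen so that rotation by `u` multiplies the integrand by `u^(n-m)
  -- = -1`.
  · set u : ℂ := Complex.exp ((Real.pi / ((n : ℝ) - m) : ℝ) * Complex.I) with hu
    have hnm : (n : ℝ) - m ≠ 0 := sub_ne_zero.2 (by exact_mod_cast h)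
    have hu1 : ‖u‖ = 1 := Complex.norm_exp_ofReal_mul_I _
    have hum : u ^ n * (starRingEnd ℂ u) ^ m = -1 := by
      have : starRingEnd ℂ u = Complex.exp (-((Real.pi / ((n : ℝ) - m) : ℝ) * Complex.I)) := by
        rw [hu, ← Complex.exp_conj]; simp
      rw [this, hu, ← Complex.exp_nat_mul, ← Complex.exp_nat_mul, ← Complex.exp_add,
        ← Complex.exp_pi_mul_I]
      congr 1
      have hc : (n : ℂ) - m ≠ 0 := by exact_mod_cast hnm
      push_cast
      field_simp
      ring
    have hfin := isFiniteMeasure_complexGaussian hb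
    have hmap : (complexGaussian b).map (u * ·) = complexGaussian b := by
      refine Measure.ext_of_charFun (funext fun t => ?_)
      rw [charFun_apply, integral_map (by fun_prop) (by fun_prop)]
      have h3 : ∀ z : ℂ, inner ℝ (u * z) t = (inner ℝ z (starRingEnd ℂ u * t) : ℝ) := fun z => by
        simp only [Complex.inner, map_mul]
        ring_nf
      simp_rw [h3]
      rw [← charFun_apply, charFun_complexGaussian hb, charFun_complexGaussian hb]
      simp [hu1]
    have h4 : ∫ z : ℂ, z ^ n * (starRingEnd ℂ z) ^ m ∂complexGaussian b
        = ∫ z : ℂ, (u * z) ^ n * (starRingEnd ℂ (u * z)) ^ m ∂complexGaussian b := by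
      conv_lhs => rw [← hmap]
      rw [integral_map (by fun_prop)]
      exact (Measurable.aestronglyMeasurable (by fun_prop))
    have h5 : ∀ z : ℂ, (u * z) ^ n * (starRingEnd ℂ (u * z)) ^ m
        = -(z ^ n * (starRingEnd ℂ z) ^ m) := fun z => by
      rw [map_mul, mul_pow, mul_pow, mul_mul_mul_comm, hum]; ring
    simp_rw [h5] at h4
    rw [integral_neg] at h4
    exact self_eq_neg.1 h4

end ComplexGaussian

/-! ### Moments of the white noise measure -/

namespace DistributionSpace

variable {N : Type*} [AddCommGroup N] [Module ℂ N] [TopologicalSpace N]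

theorem apply_add (φ : DistributionSpace N) (x y : N) : φ (x + y) = φ x + φ y :=
  map_add (show N →L[ℂ] ℂ from φ) x y

theorem apply_smul (φ : DistributionSpace N) (c : ℂ) (x : N) : φ (c • x) = c * φ x :=
  map_smul (show N →L[ℂ] ℂ from φ) c x

theorem apply_zero (φ : DistributionSpace N) : φ (0 : N) = 0 :=
  map_zero (show N →L[ℂ] ℂ from φ)

@[fun_prop]
theorem measurable_apply (ρ : N) : Measurable fun φ : DistributionSpace N => φ ρ := by
  rw [measurable_iff_comap_le, BorelSpace.measurable_eq (α := ℂ)]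
  exact le_iSup (fun ρ : N => MeasurableSpace.comap (fun φ : DistributionSpace N => φ ρ) (borel ℂ)) ρ

end DistributionSpace

namespace NuclearFrechetChain

open DistributionSpace ProbabilityTheory

variable {N : Type*} [AddCommGroup N] [Module ℂ N] [TopologicalSpace N]
  {H : ℕ → Type*} [∀ p, NormedAddCommGroup (H p)] [∀ p, InnerProductSpace ℂ (H p)]
  (C : NuclearFrechetChain N H)

/-- A vector killed in `H p` is killed in every later space, as the links are injective, hence in
all of them; uniqueness of the thread through `0` then applies. -/
theorem incl_injective (p : ℕ) : Function.Injective (C.incl p) := by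
  have h0 : ∀ x : N, C.incl p x = 0 → x = 0 := by
    intro x hx
    have h : ∀ q, C.incl q x = 0 := by
      intro q
      have h1 : C.incl (max p q) x = 0 := by
        apply C.link_injective (le_max_left p q)
        rw [C.link_incl, hx, map_zero]
      rw [← C.link_incl (le_max_right p q), h1, map_zero]
    obtain ⟨y, -, hy⟩ := C.existsUnique_of_thread (fun _ => 0) (fun _ => map_zero _)
    rw [hy x h, hy 0 (fun q => map_zero _)]
  exact (injective_iff_map_eq_zero (C.incl p)).2 h0

variable {C} {β : Measure (DistributionSpace N)}

/-- The joint characteristic function of two coordinates. The test vector `(s̄/2)ρ + (t̄/2)ρ'` turns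
`2 Re φ(·)` into the real pairing with `(s, t)`, and orthogonality makes its squared norm split,
which yields independence later. -/
theorem IsWhiteNoise.integral_exp_inner (hβ : C.IsWhiteNoise β) (ρ ρ' : N) (s t : ℂ)
    (h : inner ℂ (C.incl 0 ρ) (C.incl 0 ρ') = 0) :
    ∫ φ : DistributionSpace N, Complex.exp
      (((inner ℝ (φ ρ) s + inner ℝ (φ ρ') t : ℝ) : ℂ) * Complex.I) ∂β
      = Complex.exp (-(‖C.incl 0 ρ‖ ^ 2 * ‖s‖ ^ 2 / 4 : ℝ))
        * Complex.exp (-(‖C.incl 0 ρ'‖ ^ 2 * ‖t‖ ^ 2 / 4 : ℝ)) := by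
  have h1 := hβ ((starRingEnd ℂ s / 2) • ρ + (starRingEnd ℂ t / 2) • ρ')
  have h2 : ‖C.incl 0 ((starRingEnd ℂ s / 2) • ρ + (starRingEnd ℂ t / 2) • ρ')‖ ^ 2
      = ‖C.incl 0 ρ‖ ^ 2 * ‖s‖ ^ 2 / 4 + ‖C.incl 0 ρ'‖ ^ 2 * ‖t‖ ^ 2 / 4 := by
    rw [map_add, map_smul, map_smul, @norm_add_sq ℂ, inner_smul_left, inner_smul_right, h]
    simp only [norm_smul, norm_div, RCLike.norm_conj, mul_zero, map_zero, add_zero]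
    simp only [RCLike.norm_ofNat]
    ring
  rw [← Complex.exp_add]
  convert h1 using 1
  · refine integral_congr_ae (.of_forall fun φ => ?_)
    simp only
    congr 1
    rw [add_comm ((starRingEnd ℂ) _), Complex.add_conj, apply_add, apply_smul, apply_smul]
    rw [mul_comm]
    congr 2
    rw [Complex.inner, Complex.inner]
    simp
    ring
  · congr 1
    rw [← Complex.ofReal_pow, h2]
    push_cast; ring

theorem IsWhiteNoise.charFun_map (hβ : C.IsWhiteNoise β) (ρ : N) (t : ℂ) :
    charFun (β.map fun φ => φ ρ) t = Complex.exp (-(‖C.incl 0 ρ‖ ^ 2 * ‖t‖ ^ 2 / 4 : ℝ)) := by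
  have h := hβ.integral_exp_inner ρ 0 t 0 (by simp)
  rw [charFun_apply, integral_map (measurable_apply ρ).aemeasurable (by fun_prop)]
  simpa using h

variable [IsProbabilityMeasure β]

theorem IsWhiteNoise.indepFun (hβ : C.IsWhiteNoise β) (ρ ρ' : N)
    (h : inner ℂ (C.incl 0 ρ) (C.incl 0 ρ') = 0) :
    IndepFun (fun φ : DistributionSpace N => φ ρ) (fun φ => φ ρ') β := by
  rw [indepFun_iff_charFun_prod (measurable_apply ρ).aemeasurable (measurable_apply ρ').aemeasurable]
  intro t
  rw [hβ.charFun_map, hβ.charFun_map, ← hβ.integral_exp_inner ρ ρ' _ _ h, charFun_apply,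
    integral_map (Measurable.aemeasurable (by fun_prop)) (by fun_prop)]
  rfl

theorem IsWhiteNoise.map_eq (hβ : C.IsWhiteNoise β) {ρ : N} (hρ : ρ ≠ 0) :
    β.map (fun φ => φ ρ) = complexGaussian ((‖C.incl 0 ρ‖ ^ 2)⁻¹) := by
  have h : 0 < ‖C.incl 0 ρ‖ :=
    norm_pos_iff.2 ((map_ne_zero_iff _ (C.incl_injective 0)).2 hρ)
  refine map_eq_complexGaussian (by positivity) fun t => ?_
  rw [hβ.charFun_map, inv_inv]

theorem IsWhiteNoise.integrable_norm_pow (hβ : C.IsWhiteNoise β) (ρ : N) (k : ℕ) :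
    Integrable (fun φ : DistributionSpace N => ‖φ ρ‖ ^ k) β := by
  by_cases hρ : ρ = 0
  · subst hρ
    simp only [apply_zero]
    exact integrable_const _
  · have h : 0 < ‖C.incl 0 ρ‖ :=
      norm_pos_iff.2 ((map_ne_zero_iff _ (C.incl_injective 0)).2 hρ)
    have h1 := integrable_norm_pow_complexGaussian (b := (‖C.incl 0 ρ‖ ^ 2)⁻¹) (by positivity) k
    rw [← hβ.map_eq hρ] at h1
    exact h1.comp_measurable (measurable_apply ρ)

theorem IsWhiteNoise.integrable_pow_mul (hβ : C.IsWhiteNoise β) (ρ ρ' : N) (n m : ℕ) :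
    Integrable (fun φ : DistributionSpace N => φ ρ ^ n * (starRingEnd ℂ (φ ρ')) ^ m) β := by
  refine ((hβ.integrable_norm_pow ρ (2 * n)).add (hβ.integrable_norm_pow ρ' (2 * m))).mono'
    (Measurable.aestronglyMeasurable (by fun_prop)) (.of_forall fun φ => ?_)
  simp only [norm_mul, norm_pow, RCLike.norm_conj, Pi.add_apply]
  rw [mul_comm 2 n, mul_comm 2 m, pow_mul, pow_mul]
  nlinarith [sq_nonneg (‖φ ρ‖ ^ n - ‖φ ρ'‖ ^ m), sq_nonneg (‖φ ρ‖ ^ n), sq_nonneg (‖φ ρ'‖ ^ m)]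

theorem IsWhiteNoise.integral_pow_mul_conj_pow_self (hβ : C.IsWhiteNoise β) {ρ : N} (hρ : ρ ≠ 0)
    (n m : ℕ) : ∫ φ : DistributionSpace N, φ ρ ^ n * (starRingEnd ℂ (φ ρ)) ^ m ∂β
      = if n = m then (n.factorial : ℂ) * ((‖C.incl 0 ρ‖ : ℂ) ^ 2) ^ n else 0 := by
  have h : 0 < ‖C.incl 0 ρ‖ :=
    norm_pos_iff.2 ((map_ne_zero_iff _ (C.incl_injective 0)).2 hρ)
  have h1 := integral_pow_mul_conj_pow_complexGaussian (b := (‖C.incl 0 ρ‖ ^ 2)⁻¹)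
    (by positivity) n m
  rw [← hβ.map_eq hρ, integral_map (measurable_apply ρ).aemeasurable
    (Measurable.aestronglyMeasurable (by fun_prop)), inv_inv] at h1
  rw [h1]
  push_cast; rfl

theorem IsWhiteNoise.integral_pow (hβ : C.IsWhiteNoise β) (ρ : N) {k : ℕ} (hk : k ≠ 0) :
    ∫ φ : DistributionSpace N, φ ρ ^ k ∂β = 0 := by
  by_cases hρ : ρ = 0
  · simp [hρ, apply_zero, hk]
  · simpa [hk] using hβ.integral_pow_mul_conj_pow_self hρ k 0

/-- The mixed moments of two white noise coordinates. -/
theorem IsWhiteNoise.integral_pow_mul_conj_pow (hβ : C.IsWhiteNoise β) (ρ ρ' : N) (n m : ℕ) :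
    ∫ φ : DistributionSpace N, φ ρ ^ n * (starRingEnd ℂ (φ ρ')) ^ m ∂β
      = if n = m then (n.factorial : ℂ) * (inner ℂ (C.incl 0 ρ') (C.incl 0 ρ)) ^ n else 0 := by
  -- Separate because `φ(ρ')` is then identically zero, with no Gaussian density, and the projection
  -- below divides by `‖ρ'‖²`.
  by_cases hρ' : ρ' = 0
  · subst hρ'
    simp only [apply_zero, map_zero, inner_zero_left]
    rcases eq_or_ne m 0 with rfl | hm
    · rcases eq_or_ne n 0 with rfl | hn
      · simp
      · simpa [hn] using hβ.integral_pow ρ hn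
    · simp [hm]
      rintro rfl
      exact .inr hm
  have h : ‖C.incl 0 ρ'‖ ≠ 0 :=
    norm_ne_zero_iff.2 ((map_ne_zero_iff _ (C.incl_injective 0)).2 hρ')
  have hc : (‖C.incl 0 ρ'‖ : ℂ) ≠ 0 := by exact_mod_cast h
  set s : ℂ := inner ℂ (C.incl 0 ρ') (C.incl 0 ρ) with hs
  -- Gram–Schmidt: `ρ = aρ' + ζ` with `ζ` orthogonal to `ρ'`, so `φ(ζ)` is independent of `φ(ρ')`
  -- and the binomial expansion integrates term by term.
  set a : ℂ := s / (‖C.incl 0 ρ'‖ : ℂ) ^ 2 with ha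
  set ζ : N := ρ + (-a) • ρ' with hζ
  have horth : inner ℂ (C.incl 0 ρ') (C.incl 0 ζ) = 0 := by
    rw [hζ, map_add, map_smul, inner_add_right, inner_smul_right, inner_self_eq_norm_sq_to_K, ← hs,
      ha]
    simp only [Complex.coe_algebraMap]
    field_simp
    ring
  have hind := hβ.indepFun ρ' ζ horth
  have hdec : ∀ φ : DistributionSpace N, φ ρ = a * φ ρ' + φ ζ := fun φ => by
    rw [hζ, apply_add, apply_smul]; ring
  have hint : ∀ k, ∫ φ : DistributionSpace N,
      (φ ρ' ^ k * (starRingEnd ℂ (φ ρ')) ^ m) * φ ζ ^ (n - k) ∂β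
      = (∫ φ : DistributionSpace N, φ ρ' ^ k * (starRingEnd ℂ (φ ρ')) ^ m ∂β)
        * ∫ φ : DistributionSpace N, φ ζ ^ (n - k) ∂β := fun k => by
    have h1 := hind.comp (φ := fun z : ℂ => z ^ k * (starRingEnd ℂ z) ^ m)
      (ψ := fun z : ℂ => z ^ (n - k)) (by fun_prop) (by fun_prop)
    exact h1.integral_fun_mul_eq_mul_integral
      (Measurable.aestronglyMeasurable (by fun_prop))
      (Measurable.aestronglyMeasurable (by fun_prop))
  have hexp : ∀ φ : DistributionSpace N, φ ρ ^ n * (starRingEnd ℂ (φ ρ')) ^ m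
      = ∑ k ∈ Finset.range (n + 1), (a ^ k * (n.choose k : ℂ)) *
        ((φ ρ' ^ k * (starRingEnd ℂ (φ ρ')) ^ m) * φ ζ ^ (n - k)) := fun φ => by
    rw [hdec φ, add_pow, Finset.sum_mul]
    exact Finset.sum_congr rfl fun k _ => by rw [mul_pow]; ring
  have hintegrable : ∀ k, Integrable (fun φ : DistributionSpace N =>
      (φ ρ' ^ k * (starRingEnd ℂ (φ ρ')) ^ m) * φ ζ ^ (n - k)) β := fun k => by
    have h1 := hind.comp (φ := fun z : ℂ => z ^ k * (starRingEnd ℂ z) ^ m)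
      (ψ := fun z : ℂ => z ^ (n - k)) (by fun_prop) (by fun_prop)
    exact h1.integrable_mul (hβ.integrable_pow_mul ρ' ρ' k m)
      (by simpa [Function.comp_def] using hβ.integrable_pow_mul ζ ζ (n - k) 0)
  simp_rw [hexp]
  rw [integral_finsetSum _ fun k _ => (hintegrable k).const_mul _]
  simp_rw [integral_const_mul, hint]
  -- The terms with `k < n` contain a positive power of `φ(ζ)`, whose mean vanishes.
  rw [Finset.sum_eq_single n]
  · rw [hβ.integral_pow_mul_conj_pow_self hρ']
    split_ifs with hnm
    · simp only [Nat.choose_self, Nat.sub_self, pow_zero, integral_const, ha]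
      simp only [Nat.cast_one, mul_one, probReal_univ, one_smul]
      rw [div_pow]
      field_simp
    · simp
  · intro k hk hkn
    rw [hβ.integral_pow ζ (by have := Finset.mem_range.1 hk; omega)]
    ring
  · simp

end NuclearFrechetChain

/-! ### Polarization -/

/-- The sum factors over `i` into `1 + (-1)^(m_i + 1)`, where `m_i` counts the preimages of `i`. All
`m_i = 1` for a bijection; otherwise some `m_i = 0` and its factor vanishes. -/
theorem sum_signs_prod_mul_prod {n : ℕ} (r : Fin n → Fin n) :
    ∑ ε ∈ Fintype.piFinset (fun _ : Fin n => ({1, -1} : Finset ℂ)),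
      (∏ i, ε i) * ∏ k, ε (r k) = if Function.Bijective r then 2 ^ n else 0 := by
  have h1 : ∀ ε : Fin n → ℂ, (∏ i, ε i) * ∏ k, ε (r k)
      = ∏ i, ε i ^ (Finset.card {k | r k = i} + 1) := fun ε => by
    rw [← Finset.prod_fiberwise Finset.univ r (fun k => ε (r k)), ← Finset.prod_mul_distrib]
    refine Finset.prod_congr rfl fun i _ => ?_
    rw [pow_succ', Finset.prod_congr rfl (g := fun _ => ε i), Finset.prod_const]
    intro k hk
    rw [(Finset.mem_filter.1 hk).2]
  simp_rw [h1]
  rw [← Finset.prod_univ_sum (fun _ : Fin n => ({1, -1} : Finset ℂ))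
    (fun i e => e ^ (Finset.card {k | r k = i} + 1))]
  have h2 : ∀ m : ℕ, ∑ e ∈ ({1, -1} : Finset ℂ), e ^ m = 1 + (-1) ^ m := fun m => by
    rw [Finset.sum_pair (by norm_num), one_pow]
  simp_rw [h2]
  split_ifs with hr
  · have h3 : ∀ i, Finset.card {k | r k = i} = 1 := fun i => by
      obtain ⟨k, rfl⟩ := hr.2 i
      simp only [hr.1.eq_iff]
      rw [Finset.card_eq_one]
      exact ⟨k, by ext; simp⟩
    simp only [h3]
    norm_num
  · have h3 : ¬ Function.Surjective r := fun h => hr (Finite.injective_iff_surjective.2 h |> (⟨·, h⟩))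
    obtain ⟨i, hi⟩ := not_forall.1 h3
    refine Finset.prod_eq_zero (Finset.mem_univ i) ?_
    have h4 : Finset.card {k | r k = i} = 0 := by
      rw [Finset.card_eq_zero, Finset.filter_eq_empty_iff]
      exact fun k _ hk => hi ⟨k, hk⟩
    rw [h4]; norm_num

/-- Polarization: expand the diagonal values over all maps `r`; averaging against the signs leaves
only the bijective ones. -/
theorem MultilinearMap.two_pow_smul_sum_perm {V M : Type*} [AddCommGroup V] [Module ℂ V]
    [AddCommGroup M] [Module ℂ M] {n : ℕ} (f : MultilinearMap ℂ (fun _ : Fin n => V) M)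
    (χ : Fin n → V) :
    (2 : ℂ) ^ n • ∑ σ : Equiv.Perm (Fin n), f (fun i => χ (σ i))
      = ∑ ε ∈ Fintype.piFinset (fun _ : Fin n => ({1, -1} : Finset ℂ)),
        (∏ i, ε i) • f (fun _ => ∑ i, ε i • χ i) := by
  have h1 : ∀ ε : Fin n → ℂ, f (fun _ => ∑ i, ε i • χ i)
      = ∑ r : Fin n → Fin n, (∏ k, ε (r k)) • f (fun k => χ (r k)) := fun ε => by
    rw [f.map_sum (fun _ j => ε j • χ j)]
    exact Finset.sum_congr rfl fun r _ => f.map_smul_univ (fun k => ε (r k)) _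
  simp_rw [h1, Finset.smul_sum, smul_smul]
  rw [Finset.sum_comm]
  simp_rw [← Finset.sum_smul, sum_signs_prod_mul_prod, ite_smul, zero_smul]
  rw [← Finset.sum_filter]
  symm
  refine Finset.sum_bij (fun r hr => Equiv.ofBijective r (Finset.mem_filter.1 hr).2) ?_ ?_ ?_ ?_
  · simp
  · intro r _ r' _ h
    exact congrArg (fun σ : Equiv.Perm (Fin n) => (σ : Fin n → Fin n)) h
  · exact fun σ _ => ⟨σ, Finset.mem_filter.2 ⟨Finset.mem_univ _, σ.bijective⟩, by ext; rfl⟩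
  · exact fun r _ => rfl

/-- Symmetrized values of a multilinear map lie in every subspace that contains its values on the
diagonal. -/
theorem MultilinearMap.sum_perm_mem {V M : Type*} [AddCommGroup V] [Module ℂ V]
    [AddCommGroup M] [Module ℂ M] {n : ℕ} (f : MultilinearMap ℂ (fun _ : Fin n => V) M)
    {W : Submodule ℂ M} (hW : ∀ x, f (fun _ => x) ∈ W) (χ : Fin n → V) :
    ∑ σ : Equiv.Perm (Fin n), f (fun i => χ (σ i)) ∈ W := by
  rw [← W.smul_mem_iff (pow_ne_zero n (two_ne_zero (α := ℂ))), f.two_pow_smul_sum_perm]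
  exact W.sum_mem fun ε _ => W.smul_mem _ (hW _)

/-! ### Gram matrices of powers -/

theorem hasSum_prod_pow {ι : Type*} {f : ι → ℂ} {s : ℂ} (hf : HasSum f s) (n : ℕ) :
    HasSum (fun i : Fin n → ι => ∏ k, f (i k)) (s ^ n) := by
  induction n with
  | zero => simp
  | succ n ih =>
    set g : (Fin n → ι) → ℂ := fun i => ∏ k, f (i k) with hg
    have hs : Summable fun p : ι × (Fin n → ι) => f p.1 * g p.2 :=
      summable_mul_of_summable_norm hf.summable.norm ih.summable.norm
    have h : HasSum (fun p : ι × (Fin n → ι) => f p.1 * g p.2) (s * s ^ n) := hf.mul ih hs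
    rw [pow_succ', ← (Fin.consEquiv (fun _ : Fin (n + 1) => ι)).hasSum_iff]
    exact h.congr_fun fun p => by simp [hg, Fin.prod_univ_succ]

section Fock

variable {K : Type*} [NormedAddCommGroup K] [InnerProductSpace ℂ K]

theorem tensorForm_apply {n : ℕ} (χ : Fin n → K) (ξ : Fin n → StrongDual ℂ K) :
    tensorForm χ ξ = ∏ i, ξ i (χ i) := by
  simp [tensorForm]

/-- The sequence whose only entry is `x ⊗ ⋯ ⊗ x` in degree `n`. -/
def fockPow (x : K) (n d : ℕ) : TensorForm K d :=
  if d = n then tensorForm (fun _ => x) else 0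

variable [CompleteSpace K]

variable (K) in
/-- The coordinates in the Fock space of a sequence of forms. -/
def fockCoord (ψ : ∀ n, TensorForm K n) (x : Σ n, Fin n → (exists_hilbertBasis ℂ K).choose) : ℂ :=
  Real.sqrt x.1.factorial * ψ x.1 (fun k => InnerProductSpace.toDual ℂ K (x.2 k : K))

theorem fockNormSq_zero_eq_tsum (ψ : ∀ n, TensorForm K n) :
    fockNormSq 0 ψ = ∑' x, ‖fockCoord K ψ x‖ₑ ^ 2 := by
  rw [ENNReal.tsum_sigma', fockNormSq]
  refine tsum_congr fun n => ?_
  simp only [TensorForm.hsNormSq, ← ENNReal.tsum_mul_left, fockCoord, enorm_mul, mul_pow]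
  have h : ‖((Real.sqrt n.factorial : ℝ) : ℂ)‖ₑ ^ 2 = n.factorial := by
    rw [← enorm_pow, ← Complex.ofReal_pow, Real.sq_sqrt (by positivity)]
    simp [enorm_eq_nnnorm]
  simp [h]

/-- Parseval in each tensor slot: the sum over multi-indices is the `n`-th power of the one-slot
sum, and different degrees have disjoint supports. The value matches the mixed moment in
`IsWhiteNoise.integral_pow_mul_conj_pow`. -/
theorem hasSum_fockCoord_fockPow (x y : K) (n m : ℕ) :
    HasSum (fun z => fockCoord K (fockPow x n) z * starRingEnd ℂ (fockCoord K (fockPow y m) z))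
      (if n = m then (n.factorial : ℂ) * inner ℂ y x ^ n else 0) := by
  split_ifs with h
  · subst h
    obtain ⟨b, hb⟩ := (exists_hilbertBasis ℂ K).choose_spec
    have h1 := hasSum_prod_pow (b.hasSum_inner_mul_inner y x) n
    rw [← (sigma_mk_injective (i := n)).hasSum_iff]
    · refine (h1.mul_left (n.factorial : ℂ)).congr_fun fun i => ?_
      have hs : ((Real.sqrt n.factorial : ℝ) : ℂ) * (Real.sqrt n.factorial : ℝ) = n.factorial := by
        rw [← Complex.ofReal_mul, Real.mul_self_sqrt (by positivity)]
        simp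
      simp only [Function.comp_apply, fockCoord, fockPow, if_true, tensorForm_apply, map_mul,
        map_prod, InnerProductSpace.toDual_apply_apply, inner_conj_symm, Complex.conj_ofReal,
        Finset.prod_mul_distrib, hb]
      rw [← hs]
      ring
    · rintro ⟨d, z⟩ hz
      have hd : d ≠ n := by
        rintro rfl; exact hz ⟨z, rfl⟩
      simp [fockCoord, fockPow, hd]
  · convert hasSum_zero with z
    by_cases hz : z.1 = n
    · have : z.1 ≠ m := fun hm => h (hz.symm.trans hm)
      simp [fockCoord, fockPow, this]
    · simp [fockCoord, fockPow, hz]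

end Fock


/-! ### Holomorphic polynomials -/

namespace HolPoly

variable {N : Type*} [AddCommGroup N] [Module ℂ N] [TopologicalSpace N]

theorem eval_eq (P : HolPoly N) {m : ℕ} (h : P.deg ≤ m) (φ : DistributionSpace N) :
    P.eval φ = ∑ n ∈ Finset.range (m + 1), (P.terms n).sum (fun χ c => c * ∏ i, φ (χ i)) := by
  refine Finset.sum_subset (Finset.range_mono (by omega)) fun n _ hn => ?_
  rw [P.terms_eq_zero n (by simpa using hn), Finsupp.sum_zero_index]

/-- The sum of two polynomials. -/
def add (P Q : HolPoly N) : HolPoly N where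
  deg := max P.deg Q.deg
  terms n := P.terms n + Q.terms n
  terms_eq_zero n hn := by
    rw [P.terms_eq_zero n (by omega), Q.terms_eq_zero n (by omega), add_zero]

/-- A multiple of a polynomial. -/
def smul (c : ℂ) (P : HolPoly N) : HolPoly N where
  deg := P.deg
  terms n := c • P.terms n
  terms_eq_zero n hn := by rw [P.terms_eq_zero n hn, smul_zero]

/-- The part of degree at most `m` of a polynomial. -/
def truncate (m : ℕ) (P : HolPoly N) : HolPoly N where
  deg := m
  terms n := if n ≤ m then P.terms n else 0
  terms_eq_zero n hn := if_neg (by omega)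

/-- A monomial. -/
def monomial {n : ℕ} (χ : Fin n → N) : HolPoly N where
  deg := n
  terms := Pi.single n (Finsupp.single χ 1)
  terms_eq_zero m hm := Pi.single_eq_of_ne (by omega) _

theorem eval_add (P Q : HolPoly N) : (P.add Q).eval = P.eval + Q.eval := by
  funext φ
  rw [Pi.add_apply, eval_eq P (le_max_left P.deg Q.deg), eval_eq Q (le_max_right P.deg Q.deg),
    ← Finset.sum_add_distrib]
  exact Finset.sum_congr rfl fun n _ =>
    Finsupp.sum_add_index' (fun _ => zero_mul _) (fun _ _ _ => add_mul _ _ _)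

theorem eval_smul (c : ℂ) (P : HolPoly N) : (P.smul c).eval = c • P.eval := by
  funext φ
  rw [Pi.smul_apply, eval, eval, Finset.smul_sum]
  refine Finset.sum_congr rfl fun n _ => ?_
  rw [smul, Finsupp.sum_smul_index' (fun _ => zero_mul _), Finsupp.smul_sum]
  simp [mul_assoc]

theorem eval_monomial {n : ℕ} (χ : Fin n → N) (φ : DistributionSpace N) :
    (monomial χ).eval φ = ∏ i, φ (χ i) := by
  rw [eval, Finset.sum_eq_single n]
  · simp [monomial, Finsupp.sum_single_index]
  · intro m _ hm
    simp [monomial, Pi.single_eq_of_ne hm]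
  · simp [monomial]

end HolPoly

/-! ### Polynomials paired with their coefficients, and their span by powers. -/

namespace NuclearFrechetChain

open DistributionSpace

variable {N : Type*} [AddCommGroup N] [Module ℂ N] [TopologicalSpace N]
  {H : ℕ → Type*} [∀ p, NormedAddCommGroup (H p)] [∀ p, InnerProductSpace ℂ (H p)]
  (C : NuclearFrechetChain N H)

theorem polyCoeff_apply (P : HolPoly N) (n : ℕ) (ξ : Fin n → StrongDual ℂ (H 0)) :
    C.polyCoeff P n ξ
      = (P.terms n).sum fun χ c => c * symTensorForm (fun i => C.incl 0 (χ i)) ξ := by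
  simp [polyCoeff, Finsupp.sum]

theorem polyCoeff_add (P Q : HolPoly N) :
    C.polyCoeff (P.add Q) = C.polyCoeff P + C.polyCoeff Q := by
  funext n
  ext ξ
  simp only [Pi.add_apply, add_apply, polyCoeff_apply]
  exact Finsupp.sum_add_index' (fun _ => zero_mul _) (fun _ _ _ => add_mul _ _ _)

theorem polyCoeff_smul (c : ℂ) (P : HolPoly N) :
    C.polyCoeff (P.smul c) = c • C.polyCoeff P := by
  funext n
  ext ξ
  simp only [Pi.smul_apply, smul_apply, polyCoeff_apply, HolPoly.smul]
  rw [Finsupp.sum_smul_index' (fun _ => zero_mul _), Finsupp.smul_sum]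
  simp [mul_assoc]

theorem polyCoeff_truncate (m : ℕ) (P : HolPoly N) (n : ℕ) :
    C.polyCoeff (P.truncate m) n = if n ≤ m then C.polyCoeff P n else 0 := by
  ext ξ
  split_ifs with h <;> simp [polyCoeff_apply, HolPoly.truncate, h]

theorem polyCoeff_monomial {n : ℕ} (χ : Fin n → N) :
    C.polyCoeff (HolPoly.monomial χ) = Pi.single n (symTensorForm fun i => C.incl 0 (χ i)) := by
  funext m
  ext ξ
  rw [polyCoeff_apply, HolPoly.monomial]
  by_cases hm : m = n
  · subst hm
    simp [Finsupp.sum_single_index]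
  · simp [Pi.single_eq_of_ne hm]

/-- The pairs of the values and the bosonic coefficients of holomorphic polynomials. -/
def polyGraph : Submodule ℂ ((DistributionSpace N → ℂ) × ∀ n, TensorForm (H 0) n) where
  carrier := Set.range fun P : HolPoly N => (P.eval, C.polyCoeff P)
  add_mem' := by
    rintro _ _ ⟨P, rfl⟩ ⟨Q, rfl⟩
    exact ⟨P.add Q, Prod.ext (HolPoly.eval_add P Q) (C.polyCoeff_add P Q)⟩
  zero_mem' := ⟨⟨0, 0, fun _ _ => rfl⟩, by
    refine Prod.ext ?_ ?_
    · funext φ; simp [HolPoly.eval]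
    · funext n; simp [polyCoeff]⟩
  smul_mem' := by
    rintro c _ ⟨P, rfl⟩
    exact ⟨P.smul c, Prod.ext (HolPoly.eval_smul c P) (C.polyCoeff_smul c P)⟩

theorem mem_polyGraph (P : HolPoly N) : (P.eval, C.polyCoeff P) ∈ C.polyGraph := ⟨P, rfl⟩

/-- The power `φ ↦ φ(ρ)ⁿ` together with its coefficients. -/
def powPair (a : N × ℕ) : (DistributionSpace N → ℂ) × ∀ n, TensorForm (H 0) n :=
  (fun φ => φ a.1 ^ a.2, fockPow (C.incl 0 a.1) a.2)

/-- A monomial together with its non-symmetrized coefficients. -/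
def monomialPair (n : ℕ) : MultilinearMap ℂ (fun _ : Fin n => N)
    ((DistributionSpace N → ℂ) × ∀ n, TensorForm (H 0) n) where
  toFun χ := (fun φ => ∏ i, φ (χ i), Pi.single n (tensorForm fun i => C.incl 0 (χ i)))
  map_update_add' := by
    intro _ χ j x y
    refine Prod.ext ?_ ?_
    · funext φ
      exact ((MultilinearMap.mkPiAlgebra ℂ (Fin n) ℂ).compLinearMap
        fun _ => (show N →L[ℂ] ℂ from φ).toLinearMap).map_update_add χ j x y
    · simp only [Prod.snd_add, ← Pi.single_add]
      congr 1
      ext ξ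
      simp only [tensorForm_apply, add_apply]
      exact ((MultilinearMap.mkPiAlgebra ℂ (Fin n) ℂ).compLinearMap
        fun i => ((ξ i).comp (C.incl 0)).toLinearMap).map_update_add χ j x y
  map_update_smul' := by
    intro _ χ j c x
    refine Prod.ext ?_ ?_
    · funext φ
      exact ((MultilinearMap.mkPiAlgebra ℂ (Fin n) ℂ).compLinearMap
        fun _ => (show N →L[ℂ] ℂ from φ).toLinearMap).map_update_smul χ j c x
    · simp only [Prod.smul_snd, ← Pi.single_smul]
      congr 1
      ext ξ
      simp only [tensorForm_apply, smul_apply]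
      exact ((MultilinearMap.mkPiAlgebra ℂ (Fin n) ℂ).compLinearMap
        fun i => ((ξ i).comp (C.incl 0)).toLinearMap).map_update_smul χ j c x

theorem monomialPair_const (n : ℕ) (ρ : N) : C.monomialPair n (fun _ => ρ) = C.powPair (ρ, n) := by
  refine Prod.ext ?_ ?_
  · funext φ; simp [monomialPair, powPair]
  · funext d
    by_cases hd : d = n
    · subst hd; simp [monomialPair, powPair, fockPow]
    · simp [monomialPair, powPair, fockPow, hd]

/-- Polarization is applied to value and coefficients jointly. `monomialPair` omits the
symmetrization; the sum over permutations restores it and leaves the value unchanged up to `n!`. -/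
theorem monomial_mem_span {n : ℕ} (χ : Fin n → N) :
    ((HolPoly.monomial χ).eval, C.polyCoeff (HolPoly.monomial χ))
      ∈ Submodule.span ℂ (Set.range C.powPair) := by
  have h := (C.monomialPair n).sum_perm_mem (W := Submodule.span ℂ (Set.range C.powPair))
    (fun ρ => by
      rw [C.monomialPair_const]
      exact Submodule.subset_span ⟨_, rfl⟩) χ
  have h2 := Submodule.smul_mem _ ((n.factorial : ℂ)⁻¹) h
  convert h2 using 1
  have hn : (n.factorial : ℂ) ≠ 0 := by exact_mod_cast n.factorial_ne_zero
  refine Prod.ext ?_ ?_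
  · funext φ
    simp only [HolPoly.eval_monomial, Prod.smul_fst, Prod.fst_sum, Pi.smul_apply, Finset.sum_apply, monomialPair,
      MultilinearMap.coe_mk]
    have : ∀ σ : Equiv.Perm (Fin n), ∏ i, φ (χ (σ i)) = ∏ i, φ (χ i) := fun σ =>
      Equiv.prod_comp σ (fun i => φ (χ i))
    simp [this, Fintype.card_perm, hn]
  · rw [polyCoeff_monomial]
    simp only [Prod.smul_snd, Prod.snd_sum, monomialPair, MultilinearMap.coe_mk, symTensorForm]
    funext d
    by_cases hd : d = n
    · subst hd; simp
    · simp [hd]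

/-- Reduces bilinear and sesquilinear identities about polynomials to powers of a single coordinate.
-/
theorem polyGraph_eq_span : C.polyGraph = Submodule.span ℂ (Set.range C.powPair) := by
  apply le_antisymm
  · rintro _ ⟨P, rfl⟩
    have h : ((P.eval, C.polyCoeff P) : (DistributionSpace N → ℂ) × ∀ n, TensorForm (H 0) n)
        = ∑ n ∈ Finset.range (P.deg + 1), (P.terms n).sum fun χ c => c •
          ((HolPoly.monomial χ).eval, C.polyCoeff (HolPoly.monomial χ)) := by
      refine Prod.ext ?_ ?_
      · funext φ
        simp only [Finsupp.sum, Prod.fst_sum, Prod.smul_fst, Finset.sum_apply, Pi.smul_apply,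
          HolPoly.eval_monomial, smul_eq_mul]
        rfl
      · funext d
        simp only [Finsupp.sum, Prod.snd_sum, Prod.smul_snd, polyCoeff_monomial, Finset.sum_apply,
          Pi.smul_apply]
        rw [Finset.sum_eq_single d]
        · simp [polyCoeff, Finsupp.sum]
        · intro n _ hn
          ext ξ
          simp [Pi.single_eq_of_ne hn.symm]
        · intro hd
          rw [P.terms_eq_zero d (by simpa using hd)]
          simp
    change (P.eval, C.polyCoeff P) ∈ _
    rw [h]
    exact Submodule.sum_mem _ fun n _ => Submodule.sum_mem _ fun χ _ =>
      Submodule.smul_mem _ _ (C.monomial_mem_span χ)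
  · rw [Submodule.span_le]
    rintro _ ⟨⟨ρ, n⟩, rfl⟩
    rw [← C.monomialPair_const]
    refine ⟨HolPoly.monomial (fun _ : Fin n => ρ), Prod.ext ?_ ?_⟩
    · funext φ; simp [HolPoly.eval_monomial, monomialPair]
    · simp only [polyCoeff_monomial, monomialPair, MultilinearMap.coe_mk]
      congr 1
      have hn : (n.factorial : ℂ) ≠ 0 := by exact_mod_cast n.factorial_ne_zero
      ext ξ
      simp [symTensorForm, Fintype.card_perm, hn]

/-- The product is the monomial of the concatenated tuple; in its degree only the pair `(n, m)`
contributes to the Cauchy product. -/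
theorem powPair_mul_mem (a b : N × ℕ) : ((C.powPair a).1 * (C.powPair b).1,
    fockMul (C.powPair a).2 (C.powPair b).2) ∈ C.polyGraph := by
  obtain ⟨ρ, n⟩ := a
  obtain ⟨ρ', m⟩ := b
  refine ⟨HolPoly.monomial (Fin.append (fun _ : Fin n => ρ) (fun _ : Fin m => ρ')),
    Prod.ext ?_ ?_⟩
  · funext φ
    simp [HolPoly.eval_monomial, powPair, Fin.prod_univ_add]
  · simp only [polyCoeff_monomial, powPair]
    funext d
    by_cases hd : d = n + m
    · subst hd
      rw [Pi.single_eq_same, fockMul, Finset.sum_eq_single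
        ⟨(n, m), Finset.HasAntidiagonal.mem_antidiagonal.2 rfl⟩]
      · rw [symTensorForm_eq_symmetrize]
        congr 1
        ext ξ
        simp [tensorForm_apply, TensorForm.tmul_apply, fockPow, Fin.prod_univ_add]
      · rintro ⟨⟨k, l⟩, hp⟩ _ hne
        have hkl := Finset.HasAntidiagonal.mem_antidiagonal.1 hp
        have hk : k ≠ n := by
          rintro rfl
          have : l = m := by simp at hkl; omega
          subst this
          exact hne rfl
        convert TensorForm.symmetrize_zero
        ext ξ
        simp [TensorForm.tmul_apply, fockPow, hk]
      · simp
    · rw [Pi.single_eq_of_ne hd, fockMul]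
      symm
      refine Finset.sum_eq_zero ?_
      rintro ⟨⟨k, l⟩, hp⟩ _
      have hkl := Finset.HasAntidiagonal.mem_antidiagonal.1 hp
      convert TensorForm.symmetrize_zero
      ext ξ
      by_cases hk : k = n
      · have hl : l ≠ m := by simp at hkl; omega
        simp [TensorForm.tmul_apply, fockPow, hl]
      · simp [TensorForm.tmul_apply, fockPow, hk]

/-- The product of polynomials corresponds to the symmetric product of their coefficients. -/
theorem mul_mem_polyGraph {x y : (DistributionSpace N → ℂ) × ∀ n, TensorForm (H 0) n}
    (hx : x ∈ C.polyGraph) (hy : y ∈ C.polyGraph) :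
    (x.1 * y.1, fockMul x.2 y.2) ∈ C.polyGraph := by
  rw [polyGraph_eq_span] at hx hy
  refine Submodule.span_induction₂
    (p := fun x y _ _ => (x.1 * y.1, fockMul x.2 y.2) ∈ C.polyGraph) ?_ ?_ ?_ ?_ ?_ ?_ ?_ hx hy
  · rintro _ _ ⟨a, rfl⟩ ⟨b, rfl⟩
    exact C.powPair_mul_mem a b
  · intro y _
    simp only [Prod.fst_zero, Prod.snd_zero, zero_mul, fockMul_zero_left]
    exact C.polyGraph.zero_mem
  · intro x _
    simp only [Prod.fst_zero, Prod.snd_zero, mul_zero, fockMul_zero_right]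
    exact C.polyGraph.zero_mem
  · intro x y z _ _ _ hx hy
    have := C.polyGraph.add_mem hx hy
    simpa [add_mul, fockMul_add_left] using this
  · intro x y z _ _ _ hx hy
    have := C.polyGraph.add_mem hx hy
    simpa [mul_add, fockMul_add_right] using this
  · intro c x y _ _ h
    have := C.polyGraph.smul_mem c h
    simpa [fockMul_smul_left] using this
  · intro c x y _ _ h
    have := C.polyGraph.smul_mem c h
    simpa [fockMul_smul_right] using this

/-! ### The Segal isometry on polynomials -/

theorem exists_finset_of_mem_polyGraph {x : (DistributionSpace N → ℂ) × ∀ n, TensorForm (H 0) n}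
    (hx : x ∈ C.polyGraph) : ∃ (s : Finset (N × ℕ)) (c : N × ℕ → ℂ),
      x = ∑ a ∈ s, c a • C.powPair a := by
  rw [polyGraph_eq_span, Finsupp.mem_span_range_iff_exists_finsupp] at hx
  obtain ⟨c, hc⟩ := hx
  exact ⟨c.support, c, hc.symm⟩

theorem measurable_of_mem_polyGraph {x : (DistributionSpace N → ℂ) × ∀ n, TensorForm (H 0) n}
    (hx : x ∈ C.polyGraph) : Measurable x.1 := by
  obtain ⟨s, c, rfl⟩ := C.exists_finset_of_mem_polyGraph hx
  have h : (∑ a ∈ s, c a • C.powPair a).1 = fun φ => ∑ a ∈ s, c a * φ a.1 ^ a.2 := by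
    funext φ
    simp [Prod.fst_sum, powPair]
  rw [h]
  fun_prop

variable [∀ p, CompleteSpace (H p)] {C} {β : Measure (DistributionSpace N)}
  [IsProbabilityMeasure β]

/-- Written as combinations of powers, both quantities are the same quadratic form in `c`, with Gram
matrix `G`: once from Gaussian moments, once from Parseval. -/
theorem IsWhiteNoise.lintegral_enorm_sq (hβ : C.IsWhiteNoise β)
    {x : (DistributionSpace N → ℂ) × ∀ n, TensorForm (H 0) n} (hx : x ∈ C.polyGraph) :
    ∫⁻ φ, ‖x.1 φ‖ₑ ^ 2 ∂β = fockNormSq 0 x.2 ∧ fockNormSq 0 x.2 < ∞ := by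
  obtain ⟨s, c, rfl⟩ := C.exists_finset_of_mem_polyGraph hx
  set f : DistributionSpace N → ℂ := (∑ a ∈ s, c a • C.powPair a).1 with hf
  set ψ : ∀ n, TensorForm (H 0) n := (∑ a ∈ s, c a • C.powPair a).2 with hψ
  set G : N × ℕ → N × ℕ → ℂ := fun a b =>
    if a.2 = b.2 then (a.2.factorial : ℂ) * inner ℂ (C.incl 0 b.1) (C.incl 0 a.1) ^ a.2 else 0
  have hsq : ∀ z : ℂ, ((‖z‖ ^ 2 : ℝ) : ℂ) = z * starRingEnd ℂ z := fun z => by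
    rw [Complex.mul_conj, Complex.normSq_eq_norm_sq]
  have hf1 : ∀ φ, ((‖f φ‖ ^ 2 : ℝ) : ℂ) = ∑ a ∈ s, ∑ b ∈ s, (c a * starRingEnd ℂ (c b)) *
      (φ a.1 ^ a.2 * (starRingEnd ℂ (φ b.1)) ^ b.2) := fun φ => by
    have : f φ = ∑ a ∈ s, c a * φ a.1 ^ a.2 := by
      simp [hf, Prod.fst_sum, powPair]
    rw [hsq, this, map_sum, Finset.sum_mul_sum]
    refine Finset.sum_congr rfl fun a _ => Finset.sum_congr rfl fun b _ => ?_
    rw [map_mul, map_pow]; ring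
  have hint : Integrable (fun φ => ((‖f φ‖ ^ 2 : ℝ) : ℂ)) β := by
    simp_rw [hf1]
    exact integrable_finsetSum _ fun a _ => integrable_finsetSum _ fun b _ =>
      (hβ.integrable_pow_mul a.1 b.1 a.2 b.2).const_mul _
  have hintr : Integrable (fun φ => ‖f φ‖ ^ 2) β := by
    simpa only [RCLike.re_eq_complex_re, Complex.ofReal_re] using hint.re
  have hI : ((∫ φ, ‖f φ‖ ^ 2 ∂β : ℝ) : ℂ)
      = ∑ a ∈ s, ∑ b ∈ s, (c a * starRingEnd ℂ (c b)) * G a b := by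
    rw [← integral_complex_ofReal]
    simp_rw [hf1]
    rw [integral_finsetSum _ fun a _ => integrable_finsetSum _ fun b _ =>
      (hβ.integrable_pow_mul a.1 b.1 a.2 b.2).const_mul _]
    refine Finset.sum_congr rfl fun a _ => ?_
    rw [integral_finsetSum _ fun b _ => (hβ.integrable_pow_mul a.1 b.1 a.2 b.2).const_mul _]
    refine Finset.sum_congr rfl fun b _ => ?_
    rw [integral_const_mul, hβ.integral_pow_mul_conj_pow]
  have hψ1 : ∀ z, ((‖fockCoord (H 0) ψ z‖ ^ 2 : ℝ) : ℂ) = ∑ a ∈ s, ∑ b ∈ s,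
      (c a * starRingEnd ℂ (c b)) * (fockCoord (H 0) (fockPow (C.incl 0 a.1) a.2) z *
        starRingEnd ℂ (fockCoord (H 0) (fockPow (C.incl 0 b.1) b.2) z)) := fun z => by
    have : fockCoord (H 0) ψ z
        = ∑ a ∈ s, c a * fockCoord (H 0) (fockPow (C.incl 0 a.1) a.2) z := by
      simp only [fockCoord, hψ, Prod.snd_sum, powPair, Prod.smul_mk, Finset.sum_apply, sum_apply,
        Pi.smul_apply, smul_apply, Finset.mul_sum, smul_eq_mul]
      exact Finset.sum_congr rfl fun a _ => mul_left_comm _ _ _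
    rw [hsq, this, map_sum, Finset.sum_mul_sum]
    refine Finset.sum_congr rfl fun a _ => Finset.sum_congr rfl fun b _ => ?_
    rw [map_mul]; ring
  have hS : HasSum (fun z => ((‖fockCoord (H 0) ψ z‖ ^ 2 : ℝ) : ℂ))
      ((∫ φ, ‖f φ‖ ^ 2 ∂β : ℝ) : ℂ) := by
    rw [hI]
    simp_rw [hψ1]
    exact hasSum_sum fun a _ => hasSum_sum fun b _ =>
      (hasSum_fockCoord_fockPow (C.incl 0 a.1) (C.incl 0 b.1) a.2 b.2).mul_left _
  have hS' : HasSum (fun z => ‖fockCoord (H 0) ψ z‖ ^ 2) (∫ φ, ‖f φ‖ ^ 2 ∂β) := by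
    exact_mod_cast hS
  have he : ∀ z : ℂ, ‖z‖ₑ ^ 2 = ENNReal.ofReal (‖z‖ ^ 2) := fun z => by
    rw [ENNReal.ofReal_pow (norm_nonneg _), ofReal_norm]
  rw [fockNormSq_zero_eq_tsum]
  simp_rw [he]
  rw [← ofReal_integral_eq_lintegral_ofReal hintr (.of_forall fun _ => sq_nonneg _),
    ← ENNReal.ofReal_tsum_of_nonneg (fun _ => sq_nonneg _) hS'.summable, hS'.tsum_eq]
  exact ⟨rfl, ENNReal.ofReal_lt_top⟩

theorem IsWhiteNoise.eLpNorm_sq (hβ : C.IsWhiteNoise β)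
    {x : (DistributionSpace N → ℂ) × ∀ n, TensorForm (H 0) n} (hx : x ∈ C.polyGraph) :
    eLpNorm x.1 2 β ^ 2 = fockNormSq 0 x.2 := by
  rw [← (hβ.lintegral_enorm_sq hx).1]
  simpa using eLpNorm_nnreal_pow_eq_lintegral (μ := β) (f := x.1) (p := 2) two_ne_zero

theorem IsWhiteNoise.memLp (hβ : C.IsWhiteNoise β)
    {x : (DistributionSpace N → ℂ) × ∀ n, TensorForm (H 0) n} (hx : x ∈ C.polyGraph) :
    MemLp x.1 2 β := by
  refine ⟨(C.measurable_of_mem_polyGraph hx).aestronglyMeasurable, ?_⟩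
  have h := (hβ.lintegral_enorm_sq hx).2
  rw [← hβ.eLpNorm_sq hx] at h
  exact (ENNReal.pow_lt_top_iff.1 h).resolve_right two_ne_zero

end NuclearFrechetChain

/-! ### Test functions as elements of `L²` -/

theorem ENNReal.tendsto_zero_of_le_two_mul_add {a b c : ℕ → ℝ≥0∞} (ha : Tendsto a atTop (𝓝 0))
    (hb : Tendsto b atTop (𝓝 0)) (h : ∀ k, c k ≤ 2 * (a k + b k)) : Tendsto c atTop (𝓝 0) := by
  have h1 : Tendsto (fun k => 2 * (a k + b k)) atTop (𝓝 0) := by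
    simpa using ENNReal.Tendsto.const_mul (ha.add hb) (Or.inr ENNReal.ofNat_ne_top)
  exact tendsto_of_tendsto_of_tendsto_of_le_of_le tendsto_const_nhds h1 (fun _ => zero_le) h

theorem ENNReal.tendsto_sq_zero_iff {a : ℕ → ℝ≥0∞} :
    Tendsto (fun k => a k ^ 2) atTop (𝓝 0) ↔ Tendsto a atTop (𝓝 0) := by
  constructor
  · intro h
    have h1 := ((ENNReal.continuous_rpow_const (y := 1 / 2)).tendsto 0).comp h
    have h2 : ∀ x : ℝ≥0∞, (x ^ 2) ^ (1 / 2 : ℝ) = x := fun x => by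
      rw [← ENNReal.rpow_natCast, ← ENNReal.rpow_mul]; norm_num
    simpa only [Function.comp_def, h2, ENNReal.zero_rpow_of_pos (one_half_pos (α := ℝ))] using h1
  · intro h
    simpa [Function.comp_def] using ((ENNReal.continuous_pow 2).tendsto 0).comp h

/-- Every degree carries a nonzero weight, so vanishing is independent of the weight. This lifts
uniqueness of coefficients from weight 0 to the weight needed by the product estimate. -/
theorem fockNormSq_eq_zero_of_eq_zero {K : Type*} [NormedAddCommGroup K] [InnerProductSpace ℂ K]
    [CompleteSpace K] {p : ℕ} (q : ℕ) {a : ∀ n, TensorForm K n} (h : fockNormSq p a = 0) :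
    fockNormSq q a = 0 := by
  rw [fockNormSq, ENNReal.tsum_eq_zero] at h ⊢
  intro n
  have h1 : (n.factorial : ℝ≥0∞) ≠ 0 := by exact_mod_cast n.factorial_ne_zero
  have h2 := h n
  simp only [mul_eq_zero, h1, pow_eq_zero_iff', false_or] at h2
  rcases h2 with h2 | h2
  · exact absurd h2.1 two_ne_zero
  · rw [h2, mul_zero]

/-- Below degree `m` the weights differ by at most `2^(qm)`; above it only the tail of `b` is left.
-/
theorem fockNormSq_truncate_sub_le {K : Type*} [NormedAddCommGroup K] [InnerProductSpace ℂ K]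
    [CompleteSpace K] (q m : ℕ) (a b : ∀ n, TensorForm K n) :
    fockNormSq q ((fun n => if n < m then a n else 0) - b)
      ≤ 2 ^ (q * m) * fockNormSq 0 (a - b)
        + ∑' n, ((n + m).factorial : ℝ≥0∞) * 2 ^ (q * (n + m)) * (b (n + m)).hsNormSq := by
  rw [fockNormSq, ← Summable.sum_add_tsum_nat_add' (k := m) ENNReal.summable]
  refine add_le_add ?_ (ENNReal.tsum_le_tsum fun n => ?_)
  · rw [fockNormSq, ← ENNReal.tsum_mul_left]
    refine le_trans (Finset.sum_le_sum fun n hn => ?_) (ENNReal.sum_le_tsum (Finset.range m))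
    have hn' := Finset.mem_range.1 hn
    simp only [Pi.sub_apply, hn', if_true, zero_mul, pow_zero, mul_one]
    have : (2 : ℝ≥0∞) ^ (q * n) ≤ 2 ^ (q * m) :=
      pow_le_pow_right₀ one_le_two (Nat.mul_le_mul_left q hn'.le)
    rw [← mul_assoc, mul_comm ((2 : ℝ≥0∞) ^ (q * m))]
    exact mul_le_mul_left (mul_le_mul_right this _) _
  · have h : ((fun n => if n < m then a n else 0) - b) (n + m) = (-1 : ℂ) • b (n + m) := by
      ext ξ
      simp
    rw [h, TensorForm.hsNormSq_smul]
    simp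

/-! ### The extended Segal correspondence and products in `L²`. -/

namespace NuclearFrechetChain

open DistributionSpace

variable {N : Type*} [AddCommGroup N] [Module ℂ N] [TopologicalSpace N]
  {H : ℕ → Type*} [∀ p, NormedAddCommGroup (H p)] [∀ p, InnerProductSpace ℂ (H p)]
  {C : NuclearFrechetChain N H}

theorem measurable_eval (C : NuclearFrechetChain N H) (P : HolPoly N) : Measurable P.eval :=
  C.measurable_of_mem_polyGraph (C.mem_polyGraph P)

theorem link_zero (C : NuclearFrechetChain N H) :
    C.link (Nat.zero_le 0) = ContinuousLinearMap.id ℂ (H 0) := by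
  refine DFunLike.coe_injective ((C.denseRange_incl 0).equalizer
    (C.link (Nat.zero_le 0)).continuous continuous_id ?_)
  funext x
  exact C.link_incl _ x

variable [∀ p, CompleteSpace (H p)] {β : Measure (DistributionSpace N)}

theorem IsSegal.add {Ψ Φ : Lp ℂ 2 β} {ψ φ : ∀ n, TensorForm (H 0) n} (hΨ : C.IsSegal β Ψ ψ)
    (hΦ : C.IsSegal β Φ φ) : C.IsSegal β (Ψ + Φ) (ψ + φ) := by
  obtain ⟨hψ, P, hP1, hP2⟩ := hΨ
  obtain ⟨hφ, Q, hQ1, hQ2⟩ := hΦ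
  refine ⟨hψ.add hφ, fun k => (P k).add (Q k), ?_, ?_⟩
  · refine tendsto_of_tendsto_of_tendsto_of_le_of_le tendsto_const_nhds
      (by simpa using hP1.add hQ1) (fun _ => zero_le) fun k => ?_
    have h1 : (fun φ => ((P k).add (Q k)).eval φ - (Ψ + Φ : Lp ℂ 2 β) φ) =ᵐ[β]
        (fun φ => (P k).eval φ - Ψ φ) + (fun φ => (Q k).eval φ - Φ φ) := by
      filter_upwards [Lp.coeFn_add Ψ Φ] with x hx
      rw [hx, HolPoly.eval_add]
      simp only [Pi.add_apply]
      ring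
    dsimp only
    rw [eLpNorm_congr_ae h1]
    exact eLpNorm_add_le
      ((C.measurable_eval _).aestronglyMeasurable.sub (Lp.aestronglyMeasurable Ψ))
      ((C.measurable_eval _).aestronglyMeasurable.sub (Lp.aestronglyMeasurable Φ)) one_le_two
  · refine ENNReal.tendsto_zero_of_le_two_mul_add hP2 hQ2 fun k => ?_
    have h := fockNormSq_add_le 0 (C.polyCoeff (P k) - ψ) (C.polyCoeff (Q k) - φ)
    have he : (fun n => C.polyCoeff ((P k).add (Q k)) n - (ψ + φ) n)
        = (C.polyCoeff (P k) - ψ) + (C.polyCoeff (Q k) - φ) := by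
      funext n
      rw [C.polyCoeff_add]
      simp only [Pi.add_apply, Pi.sub_apply]
      abel
    rw [he]
    exact h

theorem IsSegal.smul {Ψ : Lp ℂ 2 β} {ψ : ∀ n, TensorForm (H 0) n} (hΨ : C.IsSegal β Ψ ψ) (c : ℂ) :
    C.IsSegal β (c • Ψ) (c • ψ) := by
  obtain ⟨hψ, P, hP1, hP2⟩ := hΨ
  refine ⟨hψ.smul c, fun k => (P k).smul c, ?_, ?_⟩
  · have h2 := ENNReal.Tendsto.const_mul (a := ‖c‖ₑ) hP1 (Or.inr enorm_ne_top)
    rw [mul_zero] at h2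
    refine h2.congr fun k => ?_
    rw [← eLpNorm_const_smul]
    refine eLpNorm_congr_ae ?_
    filter_upwards [Lp.coeFn_smul c Ψ] with x hx
    rw [hx, HolPoly.eval_smul]
    simp [mul_sub]
  · have h2 := ENNReal.Tendsto.const_mul (a := ‖c‖ₑ ^ 2) hP2
      (Or.inr (ENNReal.pow_ne_top enorm_ne_top))
    rw [mul_zero] at h2
    refine h2.congr fun k => ?_
    rw [← fockNormSq_smul]
    congr 1
    funext n
    rw [C.polyCoeff_smul]
    ext ξ
    simp [mul_sub]

/-- Working with Fock distance zero avoids deducing equality of forms from agreement on a basis. -/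
theorem IsSegal.congr {Ψ : Lp ℂ 2 β} {ψ ψ' : ∀ n, TensorForm (H 0) n} (h : C.IsSegal β Ψ ψ)
    (hs : ∀ n, (ψ' n).IsSymm) (h0 : fockNormSq 0 (ψ - ψ') = 0) : C.IsSegal β Ψ ψ' := by
  obtain ⟨hψ, P, hP1, hP2⟩ := h
  refine ⟨⟨hs, ?_⟩, P, hP1, ?_⟩
  · have h1 := fockNormSq_add_le 0 ψ (-(ψ - ψ'))
    rw [fockNormSq_neg, h0, add_zero, show ψ + -(ψ - ψ') = ψ' by
      funext n; ext ξ; simp] at h1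
    exact h1.trans_lt (ENNReal.mul_lt_top (by simp) hψ.2)
  · refine ENNReal.tendsto_zero_of_le_two_mul_add hP2 tendsto_const_nhds
      (fun k => ?_) (b := fun _ => 0)
    have h1 := fockNormSq_sub_le 0 (C.polyCoeff (P k)) ψ ψ'
    rwa [h0] at h1

theorem segalPreimage_add {p q : ℕ} {Ψ Φ : Lp ℂ 2 β} (hΨ : Ψ ∈ C.segalPreimage β p q)
    (hΦ : Φ ∈ C.segalPreimage β p q) : Ψ + Φ ∈ C.segalPreimage β p q := by
  obtain ⟨ψ, hψ, h1⟩ := hΨ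
  obtain ⟨φ, hφ, h2⟩ := hΦ
  exact ⟨ψ + φ, hψ.add hφ, h1.add h2⟩

theorem segalPreimage_smul {p q : ℕ} {Ψ : Lp ℂ 2 β} (hΨ : Ψ ∈ C.segalPreimage β p q) (c : ℂ) :
    c • Ψ ∈ C.segalPreimage β p q := by
  obtain ⟨ψ, hψ, h1⟩ := hΨ
  exact ⟨c • ψ, hψ.smul c, h1.smul c⟩

variable [IsProbabilityMeasure β]

theorem isSegal_one : C.IsSegal β ((memLp_const (1 : ℂ)).toLp _) (fockConst (H 0) 1) := by
  refine ⟨isFock_fockConst 0 1, fun _ => HolPoly.monomial (n := 0) Fin.elim0, ?_, ?_⟩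
  · refine tendsto_const_nhds.congr fun k => ?_
    symm
    rw [← eLpNorm_zero (ε := ℂ) (p := 2) (μ := β)]
    refine eLpNorm_congr_ae ?_
    filter_upwards [(memLp_const (1 : ℂ) (μ := β) (p := 2)).coeFn_toLp] with x hx
    rw [hx, HolPoly.eval_monomial]
    simp
  · refine tendsto_const_nhds.congr fun k => ?_
    symm
    rw [← fockNormSq_zero (K := H 0) 0]
    congr 1
    funext n
    rw [C.polyCoeff_monomial]
    ext ξ
    cases n
    · simp [fockConst, symTensorForm, tensorForm_apply]
    · simp [fockConst]

theorem one_mem_segalPreimage (p q : ℕ) :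
    (memLp_const (1 : ℂ)).toLp _ ∈ C.segalPreimage β p q :=
  ⟨fockConst (H p) 1, isFock_fockConst q 1, by simpa only [map_fockConst] using isSegal_one⟩

theorem IsWhiteNoise.eLpNorm_eval_sub_sq (hβ : C.IsWhiteNoise β) (P Q : HolPoly N) :
    eLpNorm (P.eval - Q.eval) 2 β ^ 2 = fockNormSq 0 (C.polyCoeff P - C.polyCoeff Q) :=
  hβ.eLpNorm_sq (x := (P.eval, C.polyCoeff P) - (Q.eval, C.polyCoeff Q))
    (by
      have h := C.polyGraph.add_mem (C.mem_polyGraph P)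
        (C.polyGraph.smul_mem (-1) (C.mem_polyGraph Q))
      convert h using 1
      refine Prod.ext ?_ ?_
      · funext φ; simp [sub_eq_add_neg]
      · funext n; ext ξ; simp [sub_eq_add_neg])

/-- The chaos coefficients of a function are determined by it. -/
theorem IsSegal.fockNormSq_sub_eq_zero (hβ : C.IsWhiteNoise β) {Ψ : Lp ℂ 2 β} {ψ ψ' : ∀ n, TensorForm (H 0) n}
    (h : C.IsSegal β Ψ ψ) (h' : C.IsSegal β Ψ ψ') : fockNormSq 0 (ψ - ψ') = 0 := by
  obtain ⟨-, P, hP1, hP2⟩ := h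
  obtain ⟨-, Q, hQ1, hQ2⟩ := h'
  have h1 : Tendsto (fun k => eLpNorm ((P k).eval - (Q k).eval) 2 β) atTop (𝓝 0) := by
    refine tendsto_of_tendsto_of_tendsto_of_le_of_le tendsto_const_nhds
      (by simpa using hP1.add hQ1) (fun _ => zero_le) fun k => ?_
    have h2 : (P k).eval - (Q k).eval
        = (fun φ => (P k).eval φ - Ψ φ) - (fun φ => (Q k).eval φ - Ψ φ) := by
      funext φ; simp
    dsimp only
    rw [h2]
    exact eLpNorm_sub_le
      ((C.measurable_eval _).aestronglyMeasurable.sub (Lp.aestronglyMeasurable Ψ))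
      ((C.measurable_eval _).aestronglyMeasurable.sub (Lp.aestronglyMeasurable Ψ)) one_le_two
  rw [← ENNReal.tendsto_sq_zero_iff] at h1
  simp_rw [hβ.eLpNorm_eval_sub_sq] at h1
  have h3 : Tendsto (fun k => fockNormSq 0 (C.polyCoeff (P k) - ψ')) atTop (𝓝 0) :=
    ENNReal.tendsto_zero_of_le_two_mul_add h1 hQ2 fun k => fockNormSq_sub_le 0 _ _ _
  have h4 : Tendsto (fun _ : ℕ => fockNormSq 0 (ψ - ψ')) atTop (𝓝 0) := by
    refine ENNReal.tendsto_zero_of_le_two_mul_add hP2 h3 fun k => ?_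
    have := fockNormSq_sub_le 0 ψ (C.polyCoeff (P k)) ψ'
    rwa [fockNormSq_sub_comm 0 ψ (C.polyCoeff (P k))] at this
  exact tendsto_nhds_unique tendsto_const_nhds h4

/-- Approximation by polynomials in a stronger Fock norm. -/
theorem IsSegal.exists_tendsto_fockNormSq (hβ : C.IsWhiteNoise β) {Ψ : Lp ℂ 2 β} {ψ : ∀ n, TensorForm (H 0) n}
    (h : C.IsSegal β Ψ ψ) (q : ℕ) (hq : fockNormSq q ψ < ∞) : ∃ P : ℕ → HolPoly N,
      Tendsto (fun k => eLpNorm (fun φ => (P k).eval φ - Ψ φ) 2 β) atTop (𝓝 0) ∧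
      Tendsto (fun k => fockNormSq q (C.polyCoeff (P k) - ψ)) atTop (𝓝 0) := by
  obtain ⟨-, P, hP1, hP2⟩ := h
  have key : ∀ ε : ℝ≥0∞, 0 < ε → ∃ Q : HolPoly N, fockNormSq q (C.polyCoeff Q - ψ) < ε := by
    intro ε hε
    have hε2 : 0 < ε / 2 := ENNReal.half_pos hε.ne'
    have ht := ENNReal.tendsto_sum_nat_add
      (fun n => (n.factorial : ℝ≥0∞) * 2 ^ (q * n) * (ψ n).hsNormSq) hq.ne
    -- The cutoff `m` is fixed first, by the tail of `ψ`; only then is `k` chosen against the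
    -- constant `2^(qm)`. Since `truncate` keeps its bound, degrees below `m` require `m - 1`, hence
    -- `m ≥ 1`.
    obtain ⟨m, hm, hm0⟩ := ((ht.eventually_lt_const hε2).and (eventually_ge_atTop 1)).exists
    have hk := ENNReal.Tendsto.const_mul (a := (2 : ℝ≥0∞) ^ (q * m)) hP2
      (Or.inr (ENNReal.pow_ne_top ENNReal.ofNat_ne_top))
    rw [mul_zero] at hk
    obtain ⟨k, hk⟩ := (hk.eventually_lt_const hε2).exists
    refine ⟨(P k).truncate (m - 1), ?_⟩
    have h1 : C.polyCoeff ((P k).truncate (m - 1))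
        = fun n => if n < m then C.polyCoeff (P k) n else 0 := by
      funext n
      rw [C.polyCoeff_truncate]
      congr 1
      exact propext (by omega)
    rw [h1, ← ENNReal.add_halves ε]
    exact (fockNormSq_truncate_sub_le q m _ _).trans_lt (ENNReal.add_lt_add hk hm)
  choose Q hQ using fun k : ℕ => key ((k : ℝ≥0∞)⁻¹) (ENNReal.inv_pos.2 (ENNReal.natCast_ne_top k))
  have hQ2 : Tendsto (fun k => fockNormSq q (C.polyCoeff (Q k) - ψ)) atTop (𝓝 0) :=
    tendsto_of_tendsto_of_tendsto_of_le_of_le tendsto_const_nhds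
      ENNReal.tendsto_inv_nat_nhds_zero (fun _ => zero_le) fun k => (hQ k).le
  refine ⟨Q, ?_, hQ2⟩
  have hQ0 : Tendsto (fun k => fockNormSq 0 (C.polyCoeff (Q k) - ψ)) atTop (𝓝 0) :=
    tendsto_of_tendsto_of_tendsto_of_le_of_le tendsto_const_nhds hQ2 (fun _ => zero_le)
      fun k => fockNormSq_mono (Nat.zero_le q) _
  -- The new polynomials inherit the `L²` limit: by the isometry, their distance to the old ones is
  -- a weight-0 Fock distance.
  have h3 : Tendsto (fun k => eLpNorm ((Q k).eval - (P k).eval) 2 β) atTop (𝓝 0) := by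
    rw [← ENNReal.tendsto_sq_zero_iff]
    simp_rw [hβ.eLpNorm_eval_sub_sq]
    refine ENNReal.tendsto_zero_of_le_two_mul_add hQ0 hP2 fun k => ?_
    have := fockNormSq_sub_le 0 (C.polyCoeff (Q k)) ψ (C.polyCoeff (P k))
    rwa [fockNormSq_sub_comm 0 ψ (C.polyCoeff (P k))] at this
  refine tendsto_of_tendsto_of_tendsto_of_le_of_le tendsto_const_nhds
    (by simpa using h3.add hP1) (fun _ => zero_le) fun k => ?_
  have h2 : (fun φ => (Q k).eval φ - Ψ φ)
      = ((Q k).eval - (P k).eval) + (fun φ => (P k).eval φ - Ψ φ) := by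
    funext φ; simp
  dsimp only
  rw [h2]
  exact eLpNorm_add_le
    ((C.measurable_eval _).aestronglyMeasurable.sub (C.measurable_eval _).aestronglyMeasurable)
    ((C.measurable_eval _).aestronglyMeasurable.sub (Lp.aestronglyMeasurable Ψ)) one_le_two

/-- If the coefficients of polynomials converge, then so do the polynomials in `L²`. -/
theorem IsWhiteNoise.exists_tendsto_eLpNorm (hβ : C.IsWhiteNoise β) {R : ℕ → HolPoly N}
    {θ : ∀ n, TensorForm (H 0) n}
    (h : Tendsto (fun k => fockNormSq 0 (C.polyCoeff (R k) - θ)) atTop (𝓝 0)) :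
    ∃ Θ : Lp ℂ 2 β, Tendsto (fun k => eLpNorm (fun φ => (R k).eval φ - Θ φ) 2 β) atTop (𝓝 0) := by
  set F : ℕ → Lp ℂ 2 β := fun k => (hβ.memLp (C.mem_polyGraph (R k))).toLp (R k).eval with hF
  have hcoe : ∀ k, F k =ᵐ[β] (R k).eval := fun k => MemLp.coeFn_toLp _
  have hcau : CauchySeq F := by
    rw [EMetric.cauchySeq_iff]
    intro ε hε
    have hε' : 0 < ε ^ 2 / 4 := ENNReal.div_pos (pow_ne_zero 2 hε.ne') (by simp)
    obtain ⟨k₀, hk₀⟩ := eventually_atTop.1 (h.eventually_lt_const hε')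
    refine ⟨k₀, fun k hk l hl => ?_⟩
    have h1 : edist (F k) (F l) = eLpNorm ((R k).eval - (R l).eval) 2 β := by
      rw [Lp.edist_def]
      exact eLpNorm_congr_ae ((hcoe k).sub (hcoe l))
    have h2 : edist (F k) (F l) ^ 2 < ε ^ 2 := by
      rw [h1, hβ.eLpNorm_eval_sub_sq]
      have h3 := fockNormSq_sub_le 0 (C.polyCoeff (R k)) θ (C.polyCoeff (R l))
      rw [fockNormSq_sub_comm 0 θ (C.polyCoeff (R l))] at h3
      refine h3.trans_lt ?_
      calc _ < 2 * (ε ^ 2 / 4 + ε ^ 2 / 4) := by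
            exact ENNReal.mul_lt_mul_right (by simp) (by simp)
              (ENNReal.add_lt_add (hk₀ k hk) (hk₀ l hl))
        _ = ε ^ 2 := by
            rw [← ENNReal.add_div, ← mul_div_assoc, ← two_mul, ← mul_assoc, mul_comm]
            rw [show (2 * 2 : ℝ≥0∞) = 4 by norm_num]
            exact ENNReal.mul_div_cancel_right (by simp) (by simp)
    exact lt_of_not_ge fun h => (pow_le_pow_left' h 2).not_gt h2
  obtain ⟨Θ, hΘ⟩ := cauchySeq_tendsto_of_complete hcau
  refine ⟨Θ, ?_⟩
  rw [tendsto_iff_edist_tendsto_0] at hΘ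
  refine hΘ.congr fun k => ?_
  rw [Lp.edist_def]
  exact eLpNorm_congr_ae ((hcoe k).sub .rfl)

/-- Approximation at weight 2 makes the products' coefficients converge at weight 0, and
completeness of `L²` supplies the limit `Θ`. Products need not converge in `L²` from `L²`
convergence of the factors, so `Θ` is identified by almost everywhere convergence. -/
theorem IsSegal.exists_mul (hβ : C.IsWhiteNoise β) {Ψ Φ : Lp ℂ 2 β} {ψ φ : ∀ n, TensorForm (H 0) n}
    (hΨ : C.IsSegal β Ψ ψ) (hΦ : C.IsSegal β Φ φ) (hψ : IsFock 2 ψ) (hφ : IsFock 2 φ) :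
    ∃ Θ : Lp ℂ 2 β, C.IsSegal β Θ (fockMul ψ φ) ∧ Θ =ᵐ[β] fun x => Ψ x * Φ x := by
  obtain ⟨P, hP1, hP2⟩ := hΨ.exists_tendsto_fockNormSq hβ 2 hψ.2
  obtain ⟨Q, hQ1, hQ2⟩ := hΦ.exists_tendsto_fockNormSq hβ 2 hφ.2
  choose R hR using fun k => C.mul_mem_polyGraph (C.mem_polyGraph (P k)) (C.mem_polyGraph (Q k))
  have hR1 : ∀ k, (R k).eval = (P k).eval * (Q k).eval := fun k => congrArg Prod.fst (hR k)
  have hR2 : ∀ k, C.polyCoeff (R k) = fockMul (C.polyCoeff (P k)) (C.polyCoeff (Q k)) :=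
    fun k => congrArg Prod.snd (hR k)
  have hbound : ∀ k, fockNormSq 2 (C.polyCoeff (Q k))
      ≤ 2 * (fockNormSq 2 (C.polyCoeff (Q k) - φ) + fockNormSq 2 φ) := fun k => by
    have := fockNormSq_add_le 2 (C.polyCoeff (Q k) - φ) φ
    rwa [show C.polyCoeff (Q k) - φ + φ = C.polyCoeff (Q k) from
      sub_add_cancel (C.polyCoeff (Q k)) φ] at this
  have hconv : Tendsto (fun k => fockNormSq 0 (C.polyCoeff (R k) - fockMul ψ φ)) atTop (𝓝 0) := by
    have h1 : Tendsto (fun k => fockNormSq 2 (C.polyCoeff (P k) - ψ) *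
        (2 * (fockNormSq 2 (C.polyCoeff (Q k) - φ) + fockNormSq 2 φ))) atTop (𝓝 0) := by
      have h2 := ENNReal.Tendsto.const_mul (a := 2) (hQ2.add_const (fockNormSq 2 φ))
        (Or.inr ENNReal.ofNat_ne_top)
      have h3 := ENNReal.Tendsto.mul hP2
        (Or.inr (ENNReal.mul_ne_top ENNReal.ofNat_ne_top (by simpa using hφ.2.ne))) h2
        (Or.inr ENNReal.zero_ne_top)
      simpa using h3
    have h2 : Tendsto (fun k => fockNormSq 2 ψ * fockNormSq 2 (C.polyCoeff (Q k) - φ)) atTop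
        (𝓝 0) := by
      simpa using ENNReal.Tendsto.const_mul hQ2 (Or.inr hψ.2.ne)
    refine ENNReal.tendsto_zero_of_le_two_mul_add h1 h2 fun k => ?_
    rw [hR2, fockMul_sub_fockMul]
    refine (fockNormSq_add_le 0 _ _).trans ?_
    gcongr
    · refine (fockNormSq_fockMul_le 0 _ _).trans ?_
      gcongr
      exact hbound k
    · exact fockNormSq_fockMul_le 0 _ _
  obtain ⟨Θ, hΘ⟩ := hβ.exists_tendsto_eLpNorm hconv
  refine ⟨Θ, ⟨hψ.fockMul hφ, R, hΘ, hconv⟩, ?_⟩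
  have hmeas : ∀ S : HolPoly N, AEStronglyMeasurable S.eval β := fun S =>
    (C.measurable_eval S).aestronglyMeasurable
  -- Three nested subsequences, so that `P`, `Q` and `R = PQ` all converge almost everywhere along
  -- the last one.
  obtain ⟨u, hu, hu'⟩ := (tendstoInMeasure_of_tendsto_eLpNorm two_ne_zero
    (fun k => hmeas (P k)) (Lp.aestronglyMeasurable Ψ) hP1).exists_seq_tendsto_ae
  obtain ⟨v, hv, hv'⟩ := (tendstoInMeasure_of_tendsto_eLpNorm two_ne_zero
    (fun k => hmeas (Q (u k))) (Lp.aestronglyMeasurable Φ)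
    (hQ1.comp hu.tendsto_atTop)).exists_seq_tendsto_ae
  obtain ⟨w, hw, hw'⟩ := (tendstoInMeasure_of_tendsto_eLpNorm two_ne_zero
    (fun k => hmeas (R (u (v k)))) (Lp.aestronglyMeasurable Θ)
    (hΘ.comp (hu.comp hv).tendsto_atTop)).exists_seq_tendsto_ae
  filter_upwards [hu', hv', hw'] with x h1 h2 h3
  have h4 := (h1.comp (hv.comp hw).tendsto_atTop).mul (h2.comp hw.tendsto_atTop)
  refine tendsto_nhds_unique h3 (h4.congr fun k => ?_)
  simp [hR1]

/-- `Θ` is built once, from coefficients over `H 0` at weight 2. For each `p, q`, the product of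
coefficients over `H p` at weight `q + 2` maps to a sequence at Fock distance zero from those of
`Θ`, by uniqueness and telescoping. -/
theorem IsWhiteNoise.exists_mul_mem_hidaSpace (hβ : C.IsWhiteNoise β) {Ψ Φ : Lp ℂ 2 β}
    (hΨ : Ψ ∈ C.hidaSpace β)
    (hΦ : Φ ∈ C.hidaSpace β) : ∃ Θ ∈ C.hidaSpace β, Θ =ᵐ[β] fun x => Ψ x * Φ x := by
  simp only [hidaSpace, Set.mem_iInter] at hΨ hΦ ⊢
  obtain ⟨ψ, hψ, hΨψ⟩ := hΨ 0 2
  obtain ⟨φ, hφ, hΦφ⟩ := hΦ 0 2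
  simp only [link_zero, TensorForm.map_id] at hΨψ hΦφ
  obtain ⟨Θ, hΘ, hmul⟩ := hΨψ.exists_mul hβ hΦφ hψ hφ
  refine ⟨Θ, fun p q => ?_, hmul⟩
  obtain ⟨ψ', hψ', hΨψ'⟩ := hΨ p (q + 2)
  obtain ⟨φ', hφ', hΦφ'⟩ := hΦ p (q + 2)
  refine ⟨fockMul ψ' φ', hψ'.fockMul hφ', hΘ.congr (fun n => (isSymm_fockMul _ _ n).map _) ?_⟩
  simp only [map_fockMul]
  have h1 := fockNormSq_eq_zero_of_eq_zero 2 (hΨψ.fockNormSq_sub_eq_zero hβ hΨψ')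
  have h2 := fockNormSq_eq_zero_of_eq_zero 2 (hΦφ.fockNormSq_sub_eq_zero hβ hΦφ')
  have h3 := fockNormSq_add_le 0
    (fockMul (ψ - fun n => (ψ' n).map (C.link (Nat.zero_le p))) φ)
    (fockMul (fun n => (ψ' n).map (C.link (Nat.zero_le p)))
      (φ - fun n => (φ' n).map (C.link (Nat.zero_le p))))
  have h4 := fockNormSq_fockMul_le 0 (ψ - fun n => (ψ' n).map (C.link (Nat.zero_le p))) φ
  have h5 := fockNormSq_fockMul_le 0 (fun n => (ψ' n).map (C.link (Nat.zero_le p)))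
      (φ - fun n => (φ' n).map (C.link (Nat.zero_le p)))
  rw [h1, zero_mul, nonpos_iff_eq_zero] at h4
  rw [h2, mul_zero, nonpos_iff_eq_zero] at h5
  rw [h4, h5, add_zero, mul_zero, ← fockMul_sub_fockMul, nonpos_iff_eq_zero] at h3
  exact h3

/-- The holomorphic Hida test functions form a subspace of `L²`. -/
def hidaSubmodule (C : NuclearFrechetChain N H) (β : Measure (DistributionSpace N))
    [IsProbabilityMeasure β] : Submodule ℂ (Lp ℂ 2 β) where
  carrier := C.hidaSpace β
  add_mem' := by
    intro Ψ Φ hΨ hΦ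
    simp only [hidaSpace, Set.mem_iInter] at hΨ hΦ ⊢
    exact fun p q => segalPreimage_add (hΨ p q) (hΦ p q)
  zero_mem' := by
    simp only [hidaSpace, Set.mem_iInter]
    intro p q
    -- Zero is obtained as the multiple `0 • 1` of the constant function.
    simpa using segalPreimage_smul (one_mem_segalPreimage (C := C) (β := β) p q) 0
  smul_mem' := by
    intro c Ψ hΨ
    simp only [hidaSpace, Set.mem_iInter] at hΨ ⊢
    exact fun p q => segalPreimage_smul (hΨ p q) c

end NuclearFrechetChain

end

theorem corollaryA1 {N : Type*} [AddCommGroup N] [Module ℂ N] [TopologicalSpace N]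
    {H : ℕ → Type*} [∀ p, NormedAddCommGroup (H p)] [∀ p, InnerProductSpace ℂ (H p)]
    [∀ p, CompleteSpace (H p)] [∀ p, TopologicalSpace.SeparableSpace (H p)]
    (C : NuclearFrechetChain N H) :
    -- as functions defined at every distribution
    (∃ A : Subalgebra ℂ (DistributionSpace N → ℂ),
      (A : Set (DistributionSpace N → ℂ)) = C.hidaFunctions) ∧
    -- as elements of the `L²` space of the white noise measure
    (∀ (β : Measure (DistributionSpace N)) [IsProbabilityMeasure β], C.IsWhiteNoise β →
      ∃ A : Submodule ℂ (Lp ℂ 2 β),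
        (A : Set (Lp ℂ 2 β)) = C.hidaSpace β ∧
        (∃ E ∈ A, E =ᵐ[β] fun _ => (1 : ℂ)) ∧
        ∀ Ψ ∈ A, ∀ Φ ∈ A, ∃ Θ ∈ A, Θ =ᵐ[β] fun φ => Ψ φ * Φ φ) := by
  refine ⟨⟨C.hidaSubalgebra, rfl⟩, fun β _ hβ => ⟨C.hidaSubmodule β, rfl,
    ⟨(memLp_const (1 : ℂ)).toLp _, ?_, MemLp.coeFn_toLp _⟩, fun Ψ hΨ Φ hΦ =>
      hβ.exists_mul_mem_hidaSpace hΨ hΦ⟩⟩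
  exact Set.mem_iInter₂.2 fun p q => NuclearFrechetChain.one_mem_segalPreimage p q
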